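/- Let $J(x_1,x_2,y_1,y_2)=(-y_1,-y_2,x_1,x_2)$ on $\mathbb{R}^4\cong\mathbb{C}^2$, let $\mathbb{S}^3\subset\mathbb{R}^4$ be the unit sphere with its standard metric $g_0$, and put $\xi_0(z)=-Jz$, $\eta_0=g_0(\cdot,\xi_0)$, $\varphi_0=s\circ J$ with $s$ the orthogonal projection onto $T\mathbb{S}^3$. Fix $a\in(0,1)$ and consider on $\mathbb{S}^3$ the deformed Sasakian structure $$\eta=a\eta_0,\qquad \xi=\tfrac1a\,\xi_0,\qquad \varphi=\varphi_0,\qquad g=a\,g_0+a(a-1)\,\eta_0\otimes\eta_0,$$ which has constant $\varphi$-sectional curvature $c=\frac4a-3>1$. Let $\pi:\mathbb{S}^3\to\bar M$ be the projection onto the space of orbits of $\xi$ (the Hopf fibration), where $\bar M\cong\mathbb{C}P^1$ carries the smooth structure and the metric that make $\pi:(\mathbb{S}^3,g)\to\bar M$ a Riemannian submersion. For a smooth curve $\bar\gamma:I\to\bar M$ parametrized by arc length on a non-empty open interval $I$, the Hopf cylinder $S_{\bar\gamma}=\pi^{-1}(\bar\gamma)$ is the surface $\{(s,z)\in I\times\mathbb{S}^3:\pi(z)=\bar\gamma(s)\}$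 immersed in $(\mathbb{S}^3,g)$ by $(s,z)\mapsto z$, with the induced metric. It is called proper-biharmonic if this immersion $\phi$ is biharmonic, that is $\tau_2(\phi)=-\Delta\tau(\phi)-\operatorname{trace}R(d\phi,\tau(\phi))d\phi=0$ with $\tau(\phi)=\operatorname{trace}\nabla d\phi$ and $\Delta=-\operatorname{trace}\nabla^2$, but not harmonic, that is $\tau(\phi)\not\equiv0$. Put $$A=\sqrt{\frac{3-2a-2\sqrt{(a-1)(a-2)}}{a}},\qquad B=\sqrt{\frac{3-2a+2\sqrt{(a-1)(a-2)}}{a}},$$ and, for $e_1,e_3\in\mathbb{R}^4$, $$\begin{aligned}x(u,v)={}&\sqrt{\tfrac{B}{A+B}}\Big(\cos\big(Au+\tfrac1a v\big)e_1-\sin\big(Au+\tfrac1a v\big)Je_1\Big)\\&+\sqrt{\tfrac{A}{A+B}}\Big(\cos\big(Bu-\tfrac1a v\big)e_3+\sin\big(Bu-\tfrac1a v\big)Je_3\Big).\end{aligned}$$ (i) $S_{\bar\gamma}$ is proper-biharmonic if and only if, up to reversing the orientation of $\bar\gamma$, it is parametrized by $x$: there are $\varepsilon\in\{1,-1\}$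 and an orthonormal system $\{e_1,e_3\}$ of $\mathbb{R}^4$ with $e_3$ orthogonal to $Je_1$ such that $X(u,v)=x(\varepsilon u,v)$, $(u,v)\in I\times\mathbb{R}$, is a smooth immersion into $\mathbb{S}^3$ with image $\pi^{-1}(\bar\gamma(I))$, maps each line $\{u\}\times\mathbb{R}$ onto the fibre $\pi^{-1}(\bar\gamma(u))$, and has coordinate fields $X_v=\xi$ and $X_u$ the horizontal lift of $\bar\gamma'$, of $g$-length $1$. (ii) Conversely, for every orthonormal system $\{e_1,e_3\}$ of $\mathbb{R}^4$ with $e_3$ orthogonal to $Je_1$, the map $x:\mathbb{R}^2\to\mathbb{S}^3$ is such a parametrization (with $I=\mathbb{R}$, $\varepsilon=1$) of the Hopf cylinder over a curve $\bar\gamma:\mathbb{R}\to\bar M$ parametrized by arc length, and this Hopf cylinder is proper-biharmonic. -/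

import Mathlib

open scoped ContDiff Topology InnerProductSpace

noncomputable section

namespace TannoSphere

/-! ### The unit 3-sphere with the deformed structure -/

/-- Euclidean `ℝ⁴`, with coordinates `z = (x₁, x₂, y₁, y₂)`. -/
abbrev R4 := EuclideanSpace ℝ (Fin 4)

/-- `J (x₁, x₂, y₁, y₂) = (-y₁, -y₂, x₁, x₂)`. -/
def J (z : R4) : R4 := !₂[-z 2, -z 3, z 0, z 1]

/-- The unit sphere; its tangent space at `z` is `{X | ⟪X, z⟫ = 0}`. -/
def S3 : Set R4 := Metric.sphere 0 1

/-- `ξ₀ = -Jz`. -/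
def xi0 (z : R4) : R4 := -J z

/-- `η₀ = g₀(·, ξ₀)`. -/
def eta0 (z X : R4) : ℝ := ⟪X, xi0 z⟫_ℝ

/-- `ξ = (1/a) ξ₀`. -/
def xi (a : ℝ) (z : R4) : R4 := (1 / a) • xi0 z

/-- `η = a η₀`. -/
def eta (a : ℝ) (z X : R4) : ℝ := a * eta0 z X

/-- `g = a g₀ + a (a - 1) η₀ ⊗ η₀`. -/
def g (a : ℝ) (z X Y : R4) : ℝ :=
  a * ⟪X, Y⟫_ℝ + a * (a - 1) * (eta0 z X * eta0 z Y)

/-! ### Levi-Civita connection and curvature of a metric on the sphere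

A metric `h` on the sphere is given as a field `z ↦ h z` of symmetric bilinear forms on `ℝ⁴`,
of which only the restrictions to the tangent spaces of the sphere at points of the sphere
matter. -/

/-- The correction term in Koszul's formula,
`½ ((∂_V h)(W, Z) + (∂_W h)(V, Z) - (∂_Z h)(V, W))`. -/
def koszul (h : R4 → R4 → R4 → ℝ) (z V W Z : R4) : ℝ :=
  (1 / 2) * (fderiv ℝ (fun w => h w W Z) z V + fderiv ℝ (fun w => h w V Z) z W
    - fderiv ℝ (fun w => h w V W) z Z)

/-- Koszul's formula: `D` is tangent to the sphere at `z`, and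
`h(D, Z) = h(W', Z) + ½ ((∂_V h)(W, Z) + (∂_W h)(V, Z) - (∂_Z h)(V, W))` for all tangent `Z`.
Here `W` is the value and `W'` the derivative in `ℝ⁴` of a vector field along a map,
and `V` is the velocity of the map. -/
def IsLeviCivita (h : R4 → R4 → R4 → ℝ) (z V W W' D : R4) : Prop :=
  ⟪D, z⟫_ℝ = 0 ∧ ∀ Z : R4, ⟪Z, z⟫_ℝ = 0 → h z D Z = h z W' Z + koszul h z V W Z

lemma fderiv_g (a : ℝ) (z V W Z : R4) :
    fderiv ℝ (fun w => g a w W Z) z V =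
      a * (a - 1) * (eta0 V W * eta0 z Z + eta0 z W * eta0 V Z) := by
  have key : ∀ X : R4, ∃ L : R4 →L[ℝ] ℝ, (∀ w, L w = eta0 w X) ∧
      HasFDerivAt (fun w => eta0 w X) L z := by
    intro X
    let L : R4 →ₗ[ℝ] ℝ :=
      { toFun := fun w => eta0 w X
        map_add' := fun u v => by
          simp [eta0, xi0, J, PiLp.inner_apply, Fin.sum_univ_four]; ring
        map_smul' := fun t u => by
          simp [eta0, xi0, J, PiLp.inner_apply, Fin.sum_univ_four]; ring }
    exact ⟨L.toContinuousLinearMap, fun w => rfl, L.toContinuousLinearMap.hasFDerivAt⟩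
  obtain ⟨L, hL, hLd⟩ := key W
  obtain ⟨M, hM, hMd⟩ := key Z
  have := (((hLd.mul hMd).const_mul (a * (a - 1))).const_add (a * ⟪W, Z⟫_ℝ)).fderiv
  have h2 := congrArg (fun L => L V) this
  refine Eq.trans h2 ?_
  simp [hL, hM]
  ring

/-- For the deformed metric, Koszul's formula determines a unique vector. -/
lemma existsUnique_leviCivita {a : ℝ} (ha : 0 < a) {z : R4} (hz : z ∈ S3) (V W W' : R4) :
    ∃! D, IsLeviCivita (g a) z V W W' D := by
  have hz1 : z 0 ^ 2 + z 1 ^ 2 + z 2 ^ 2 + z 3 ^ 2 = 1 := by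
    have h : ‖z‖ = 1 := by simpa [S3] using hz
    have h2 : ‖z‖ ^ 2 = 1 := by rw [h]; norm_num
    rw [EuclideanSpace.norm_sq_eq] at h2
    simpa [Fin.sum_univ_four] using h2
  have hxi : ⟪xi0 z, z⟫_ℝ = 0 := by
    simp [xi0, J, PiLp.inner_apply, Fin.sum_univ_four]; ring
  have hzz : ⟪z, z⟫_ℝ = 1 := by
    rw [PiLp.inner_apply]
    simp only [Fin.sum_univ_four, RCLike.inner_apply, conj_trivial]
    linarith
  have hxx : ⟪xi0 z, xi0 z⟫_ℝ = 1 := by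
    rw [PiLp.inner_apply]
    simp [xi0, J, Fin.sum_univ_four]
    linarith
  have hJ : ∀ X Y : R4, eta0 X Y = -⟪J X, Y⟫_ℝ := by
    intro X Y
    simp [eta0, xi0, J, PiLp.inner_apply, Fin.sum_univ_four]; ring
  have hJs : ∀ X Y : R4, eta0 X Y = -eta0 Y X := by
    intro X Y
    simp [eta0, xi0, J, PiLp.inner_apply, Fin.sum_univ_four]; ring
  have hk : ∀ Z, koszul (g a) z V W Z =
      ⟪(-(a * (a - 1))) • (eta0 z W • J V + eta0 z V • J W), Z⟫_ℝ := by
    intro Z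
    simp only [koszul, fderiv_g, inner_smul_left, inner_add_left]
    rw [hJs Z V, hJs Z W, hJs W V, hJ V Z, hJ W Z]
    simp
    ring
  set q : R4 := (-(a * (a - 1))) • (eta0 z W • J V + eta0 z V • J W) with hq
  set w : R4 := a • W' + (a * (a - 1) * eta0 z W') • xi0 z + q with hw
  have hl : ∀ Z, g a z W' Z + koszul (g a) z V W Z = ⟪w, Z⟫_ℝ := by
    intro Z
    rw [hk Z, hw]
    simp only [g, inner_add_left, inner_smul_left, eta0, real_inner_comm (xi0 z) Z]
    simp
    ring
  refine ⟨(1 / a) • (w - ⟪w, z⟫_ℝ • z) + ((1 / a ^ 2 - 1 / a) * ⟪w, xi0 z⟫_ℝ) • xi0 z,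
    ⟨?_, ?_⟩, ?_⟩
  · simp only [inner_add_left, inner_sub_left, inner_smul_left, hxi, hzz]
    simp
  · intro Z hZ
    have hxi' : ⟪z, xi0 z⟫_ℝ = 0 := by rw [real_inner_comm]; exact hxi
    have hZ' : ⟪z, Z⟫_ℝ = 0 := by rw [real_inner_comm]; exact hZ
    rw [hl Z]
    simp only [g, eta0, inner_add_left, inner_sub_left, inner_smul_left, hxi', hxx, hZ',
      real_inner_comm (xi0 z) Z]
    simp
    field_simp
    ring
  · rintro D ⟨hD, hD2⟩
    set D0 : R4 := (1 / a) • (w - ⟪w, z⟫_ℝ • z) +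
      ((1 / a ^ 2 - 1 / a) * ⟪w, xi0 z⟫_ℝ) • xi0 z with hD0
    have hgx : ∀ X, g a z X (xi0 z) = a ^ 2 * ⟪X, xi0 z⟫_ℝ := by
      intro X
      simp only [g, eta0, hxx]; ring
    have e1 : ⟪D, xi0 z⟫_ℝ = (1 / a ^ 2) * ⟪w, xi0 z⟫_ℝ := by
      have := hD2 (xi0 z) hxi
      rw [hgx, hl] at this
      rw [← this]; field_simp
    have e2 : ∀ Z, ⟪Z, z⟫_ℝ = 0 →
        a * ⟪D, Z⟫_ℝ = ⟪w, Z⟫_ℝ - a * (a - 1) * (⟪D, xi0 z⟫_ℝ * ⟪Z, xi0 z⟫_ℝ) := by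
      intro Z hZ
      have := hD2 Z hZ
      rw [hl] at this
      simp only [g, eta0] at this
      linarith
    have hDw : a • D = w - ⟪w, z⟫_ℝ • z - (a * (a - 1) * ⟪D, xi0 z⟫_ℝ) • xi0 z := by
      refine ext_inner_right ℝ fun Y => ?_
      have hdec : Y = (Y - ⟪Y, z⟫_ℝ • z) + ⟪Y, z⟫_ℝ • z := by simp
      have hY : ⟪Y - ⟪Y, z⟫_ℝ • z, z⟫_ℝ = 0 := by
        simp only [inner_sub_left, inner_smul_left, hzz]; simp
      have := e2 _ hY
      have hxi' : ⟪z, xi0 z⟫_ℝ = 0 := by rw [real_inner_comm]; exact hxi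
      simp only [inner_sub_left, inner_sub_right, inner_smul_left, inner_smul_right, hD,
        hxi'] at this
      simp only [inner_sub_left, inner_smul_left, real_inner_comm Y z,
        real_inner_comm Y (xi0 z)]
      simp at this ⊢
      linarith
    have : D = (1 / a) • (a • D) := by rw [smul_smul]; simp [ha.ne']
    rw [this, hDw, hD0, e1, smul_sub, smul_smul, sub_eq_add_neg, ← neg_smul]
    congr 2
    field_simp
    ring

/-- The vector determined by Koszul's formula. -/
def leviCivita (h : R4 → R4 → R4 → ℝ) (z V W W' : R4) : R4 :=
  Classical.epsilon (IsLeviCivita h z V W W')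

/-- Levi-Civita covariant derivative `D_v W`, at `p`, of the vector field `W` along the map `F`
into the sphere. -/
def covD {P : Type*} [NormedAddCommGroup P] [NormedSpace ℝ P] (h : R4 → R4 → R4 → ℝ)
    (F W : P → R4) (p v : P) : R4 :=
  leviCivita h (F p) (fderiv ℝ F p v) (W p) (fderiv ℝ W p v)

/-- The radial retraction onto the sphere. -/
def retr (w : R4) : R4 := ‖w‖⁻¹ • w

/-- `∇_X Y` for vector fields `X`, `Y` on the sphere (only their values on the sphere matter). -/
def nabla (h : R4 → R4 → R4 → ℝ) (X Y : R4 → R4) (z : R4) : R4 :=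
  covD h retr (fun w => Y (retr w)) z (X z)

/-- The bracket of vector fields on the sphere. -/
def bracket (X Y : R4 → R4) (z : R4) : R4 :=
  VectorField.lieBracket ℝ (fun w => X (retr w)) (fun w => Y (retr w)) z

/-- The vector field on the sphere obtained by projecting the constant field `X`;
at `z` it has the value `X` if `X` is tangent to the sphere at `z`. -/
def extend (X w : R4) : R4 := X - ⟪X, w⟫_ℝ • w

/-- `R(X, Y)Z = ∇_X ∇_Y Z - ∇_Y ∇_X Z - ∇_{[X, Y]} Z` for vectors `X`, `Y`, `Z` tangent to the
sphere at `z`, computed with tangent extensions. -/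
def curvature (h : R4 → R4 → R4 → ℝ) (z X Y Z : R4) : R4 :=
  nabla h (extend X) (nabla h (extend Y) (extend Z)) z
    - nabla h (extend Y) (nabla h (extend X) (extend Z)) z
    - nabla h (bracket (extend X) (extend Y)) (extend Z) z

/-! ### Tension and bitension field of an immersion of a plane domain into the sphere -/

/-- The parameter plane. -/
abbrev R2 := Fin 2 → ℝ

/-- The partial derivative `∂ᵢ f`. -/
def pd {E : Type*} [NormedAddCommGroup E] [NormedSpace ℝ E] (i : Fin 2) (f : R2 → E)
    (p : R2) : E :=
  fderiv ℝ f p (Pi.single i 1)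

/-- The induced metric `Gᵢⱼ = h(∂ᵢF, ∂ⱼF)`. -/
def indMetric (h : R4 → R4 → R4 → ℝ) (F : R2 → R4) (p : R2) : Matrix (Fin 2) (Fin 2) ℝ :=
  Matrix.of fun i j => h (F p) (pd i F p) (pd j F p)

/-- The Christoffel symbols `Γᵏᵢⱼ` of a metric `G` in the plane. -/
def christoffel (G : R2 → Matrix (Fin 2) (Fin 2) ℝ) (k i j : Fin 2) (p : R2) : ℝ :=
  (1 / 2) * ∑ l, (G p)⁻¹ k l *
    (pd i (fun q => G q j l) p + pd j (fun q => G q i l) p - pd l (fun q => G q i j) p)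

/-- `Dᵢ W`, for a vector field `W` along `F`. -/
def cd (h : R4 → R4 → R4 → ℝ) (F : R2 → R4) (i : Fin 2) (W : R2 → R4) (p : R2) : R4 :=
  covD h F W p (Pi.single i 1)

/-- The tension field `τ(F) = trace ∇dF`, for the induced metric on the domain. -/
def tension (h : R4 → R4 → R4 → ℝ) (F : R2 → R4) (p : R2) : R4 :=
  ∑ i, ∑ j, (indMetric h F p)⁻¹ i j •
    (cd h F i (pd j F) p - ∑ k, christoffel (indMetric h F) k i j p • pd k F p)

/-- `trace ∇²W` (that is, `-ΔW`) of a vector field `W` along `F`. -/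
def traceHess (h : R4 → R4 → R4 → ℝ) (F W : R2 → R4) (p : R2) : R4 :=
  ∑ i, ∑ j, (indMetric h F p)⁻¹ i j •
    (cd h F i (cd h F j W) p - ∑ k, christoffel (indMetric h F) k i j p • cd h F k W p)

/-- The bitension field `τ₂(F) = -Δτ(F) - trace R(dF, τ(F))dF`. -/
def bitension (h : R4 → R4 → R4 → ℝ) (F : R2 → R4) (p : R2) : R4 :=
  traceHess h F (tension h F) p
    - ∑ i, ∑ j, (indMetric h F p)⁻¹ i j •
        curvature h (F p) (pd i F p) (tension h F p) (pd j F p)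

/-! ### The orbit space and Hopf cylinders -/

/-- The orbit of `z` under the flow of `ξ`. As a map on the sphere, this is the projection `π` of
the Boothby-Wang (Hopf) fibration; the points of the orbit space are the orbits. -/
def proj (a : ℝ) (z : R4) : Set R4 :=
  {w | ∃ c : ℝ → R4, (∀ t, HasDerivAt c (xi a (c t)) t) ∧ c 0 = z ∧ ∃ t, c t = w}

/-- The horizontal part `X - η(X)ξ`. -/
def hor (a : ℝ) (z X : R4) : R4 := X - eta a z X • xi a z

/-- A smooth curve `c : I → S³/ξ` parametrized by arc length. The smooth structure and the metric
of the orbit space are those for which `π` is a Riemannian submersion: a curve is smooth if it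
has smooth local lifts, and its speed is the length of the horizontal part of the velocity of a
lift. -/
def IsUnitSpeedCurve (a : ℝ) (I : Set ℝ) (c : ℝ → Set R4) : Prop :=
  ∀ s ∈ I, ∃ γ : ℝ → R4, ∃ K : Set ℝ, IsOpen K ∧ s ∈ K ∧ ContDiffOn ℝ ∞ γ K ∧
    ∀ t ∈ K, γ t ∈ S3 ∧ proj a (γ t) = c t ∧
      g a (γ t) (hor a (γ t) (deriv γ t)) (hor a (γ t) (deriv γ t)) = 1

/-- The Hopf cylinder `π⁻¹(c(I))` as a subset of the sphere. -/
def hopfCylinder (a : ℝ) (I : Set ℝ) (c : ℝ → Set R4) : Set R4 :=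
  {z | z ∈ S3 ∧ ∃ s ∈ I, proj a z = c s}

/-- `F : U → S³` is a local parametrization of the Hopf cylinder over `c`, seen as the immersed
surface `{(s, z) | s ∈ I, z ∈ S³, π(z) = c(s)} → S³`, `(s, z) ↦ z`. -/
def IsLocalParam (a : ℝ) (I : Set ℝ) (c : ℝ → Set R4) (U : Set R2) (F : R2 → R4) : Prop :=
  IsOpen U ∧ ContDiffOn ℝ ∞ F U ∧ (∀ p ∈ U, Function.Injective (fderiv ℝ F p)) ∧
    ∃ σ : R2 → ℝ, ContDiffOn ℝ ∞ σ U ∧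
      ∀ p ∈ U, σ p ∈ I ∧ F p ∈ S3 ∧ proj a (F p) = c (σ p)

/-- The Hopf cylinder over `c` is a harmonic (that is, minimal) surface in `(S³, g)`. -/
def IsHarmonic (a : ℝ) (I : Set ℝ) (c : ℝ → Set R4) : Prop :=
  ∀ U F, IsLocalParam a I c U F → ∀ p ∈ U, tension (g a) F p = 0

/-- The Hopf cylinder over `c` is a biharmonic surface in `(S³, g)`. -/
def IsBiharmonic (a : ℝ) (I : Set ℝ) (c : ℝ → Set R4) : Prop :=
  ∀ U F, IsLocalParam a I c U F → ∀ p ∈ U, bitension (g a) F p = 0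

/-- Proper-biharmonic: biharmonic and not harmonic. -/
def IsProperBiharmonic (a : ℝ) (I : Set ℝ) (c : ℝ → Set R4) : Prop :=
  IsBiharmonic a I c ∧ ¬ IsHarmonic a I c

/-- `X : I × ℝ → S³` parametrizes the Hopf cylinder over `c`: it is a smooth immersion onto
`π⁻¹(c(I))`, the line `{u} × ℝ` is mapped onto the fibre over `c(u)`, and the coordinate fields
`X_u`, `X_v` are the horizontal lift of `c'` (horizontal of length 1) and `ξ`. -/
def IsParametrization (a : ℝ) (I : Set ℝ) (c : ℝ → Set R4) (X : ℝ → ℝ → R4) : Prop :=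
  IsLocalParam a I c {p | p 0 ∈ I} (fun p => X (p 0) (p 1)) ∧
    (fun q : ℝ × ℝ => X q.1 q.2) '' (I ×ˢ Set.univ) = hopfCylinder a I c ∧
    ∀ u ∈ I, Set.range (X u) = c u ∧
      ∀ v, deriv (fun t => X u t) v = xi a (X u v) ∧
        eta a (X u v) (deriv (fun s => X s v) u) = 0 ∧
        g a (X u v) (deriv (fun s => X s v) u) (deriv (fun s => X s v) u) = 1

/-! ### The explicit surface -/

/-- `A = √((3 - 2a - 2√((a-1)(a-2))) / a)`. -/
def cA (a : ℝ) : ℝ := √((3 - 2 * a - 2 * √((a - 1) * (a - 2))) / a)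

/-- `B = √((3 - 2a + 2√((a-1)(a-2))) / a)`. -/
def cB (a : ℝ) : ℝ := √((3 - 2 * a + 2 * √((a - 1) * (a - 2))) / a)

/-- `{e₁, e₃}` is orthonormal and `e₃` is orthogonal to `Je₁`. -/
def IsAdmissible (e₁ e₃ : R4) : Prop :=
  ‖e₁‖ = 1 ∧ ‖e₃‖ = 1 ∧ ⟪e₁, e₃⟫_ℝ = 0 ∧ ⟪e₃, J e₁⟫_ℝ = 0

/-- The explicit parametrization. -/
def surf (a : ℝ) (e₁ e₃ : R4) (u v : ℝ) : R4 :=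
  (√(cB a / (cA a + cB a)) * Real.cos (cA a * u + 1 / a * v)) • e₁
    - (√(cB a / (cA a + cB a)) * Real.sin (cA a * u + 1 / a * v)) • J e₁
    + (√(cA a / (cA a + cB a)) * Real.cos (cB a * u - 1 / a * v)) • e₃
    + (√(cA a / (cA a + cB a)) * Real.sin (cB a * u - 1 / a * v)) • J e₃

end TannoSphere

end

open scoped ContDiff Topology InnerProductSpace

noncomputable section

namespace TannoSphere

/-! ### Linear algebra of `J` -/

/-! The rotations `rot`, the flow of -J, are isometries whose orbits are the fibres. Over a
unit-speed curve choose locally a horizontal lift γ. The map `tube a γ`, (u, v) ↦ rot (v/a) (γ u),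
has a horizontal unit field and ξ as coordinate fields, so (u, v) are flat orthonormal coordinates
on the cylinder. The lift satisfies γ'' = -(1/a)γ + κJγ' (`IsHorLift.deriv_deriv`), and Jγ' is the
unit normal. With the closed forms `leviCivita_eq` and `curvature_eq` this gives, up to rotation, τ
= κJγ' and τ₂ = (κ'' - κ³ + (4/a - 4)κ) Jγ' - 3κκ' γ' - (2κ'/a) Jγ (`IsHorLift.bitension_tube`). The
curvature enters through the Ricci curvature c + 1 = 4/a - 2 of the normal direction (`curv_trace`).
So biharmonicity means that κ is locally constant with κ = 0, the minimal case, or κ² = 4(1 - a)/a.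

The definitions quantify over all local parametrizations. Each is locally the tube composed with a
change of coordinates (`IsLocalParam.exists_flatFactor`), and the traces do not depend on that
change (`IsFlatFactor.divForm_eq`).

For constant κ the equation of the lift is linear, and rot (λu) e solves it exactly when λ² + κλ -
1/a = 0. Since AB = 1/a and (B - A)² = 4(1 - a)/a, the value κ = B - A has the roots A and -B, and
the opposite sign of κ amounts to reversing u. The superpositions `genCurve` attain every horizontal
initial condition (`exists_genCurve`), and a conserved energy gives uniqueness (`eq_zero_of_ode`).
Only local lifts of the curve are available, so the identification spreads over the interval by
connectedness (`exists_genCurve_of_isProperBiharmonic`). -/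

lemma J_add (x y : R4) : J (x + y) = J x + J y := by
  ext i; fin_cases i <;> simp [J] <;> ring

lemma J_smul (t : ℝ) (x : R4) : J (t • x) = t • J x := by
  ext i; fin_cases i <;> simp [J]

lemma J_J (x : R4) : J (J x) = -x := by
  ext i; fin_cases i <;> simp [J]

lemma inner_J_left (x y : R4) : ⟪J x, y⟫_ℝ = -⟪x, J y⟫_ℝ := by
  simp [J, PiLp.inner_apply, Fin.sum_univ_four]; ring

/-- `J` as a continuous linear map. -/
def Jcl : R4 →L[ℝ] R4 :=
  LinearMap.toContinuousLinearMap { toFun := J, map_add' := J_add, map_smul' := J_smul }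

lemma Jcl_apply (x : R4) : Jcl x = J x := rfl

lemma J_neg (x : R4) : J (-x) = -J x := map_neg Jcl x

lemma J_sub (x y : R4) : J (x - y) = J x - J y := map_sub Jcl x y

lemma J_zero : J 0 = 0 := map_zero Jcl

lemma inner_J_comm (x y : R4) : ⟪x, J y⟫_ℝ = -⟪y, J x⟫_ℝ := by
  rw [← inner_J_left, real_inner_comm]

lemma inner_J_self (x : R4) : ⟪x, J x⟫_ℝ = 0 := by
  have := inner_J_comm x x
  linarith

lemma inner_J_J (x y : R4) : ⟪J x, J y⟫_ℝ = ⟪x, y⟫_ℝ := by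
  rw [inner_J_left, J_J, inner_neg_right, neg_neg]

lemma inner_self_of_mem {z : R4} (hz : z ∈ S3) : ⟪z, z⟫_ℝ = 1 := by
  have h : ‖z‖ = 1 := by simpa [S3] using hz
  rw [real_inner_self_eq_norm_sq, h]; norm_num

lemma mem_of_inner_self {z : R4} (hz : ⟪z, z⟫_ℝ = 1) : z ∈ S3 := by
  rw [real_inner_self_eq_norm_sq] at hz
  have : ‖z‖ = 1 := by nlinarith [norm_nonneg z]
  simpa [S3] using this

lemma eta0_eq (z X : R4) : eta0 z X = -⟪X, J z⟫_ℝ := by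
  simp [eta0, xi0, inner_neg_right]

/-! ### Explicit form of the Levi-Civita connection -/

/-- The Levi-Civita connection of `g a` in closed form. -/
def lc (a : ℝ) (z V W W' : R4) : R4 :=
  W' - ⟪W', z⟫_ℝ • z + (1 - a) • (eta0 z W • J V + eta0 z V • J W
    - (2 * eta0 z V * eta0 z W) • z)

/-- Skew-symmetry of J turns the derivatives of η₀ ⊗ η₀ in Koszul's formula into pairings with JV
and JW. The multiples of z in `lc` only restore tangency and are invisible to tangent test vectors.
-/
lemma isLeviCivita_lc (a : ℝ) {z : R4} (hz : z ∈ S3) {V W : R4} (hV : ⟪V, z⟫_ℝ = 0)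
    (hW : ⟪W, z⟫_ℝ = 0) (W' : R4) : IsLeviCivita (g a) z V W W' (lc a z V W W') := by
  have hzz := inner_self_of_mem hz
  have e1 : ⟪V, J z⟫_ℝ = -⟪z, J V⟫_ℝ := inner_J_comm _ _
  refine ⟨?_, fun Z hZ => ?_⟩
  · simp only [lc, eta0_eq, inner_add_left, inner_sub_left, real_inner_smul_left, hzz,
      inner_J_left]
    ring
  · have hZ' : ⟪z, Z⟫_ℝ = 0 := by rw [real_inner_comm]; exact hZ
    simp only [koszul, fderiv_g]
    simp only [g, lc, eta0_eq, inner_add_left, inner_sub_left,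
      real_inner_smul_left, inner_J_left, hZ', J_J, inner_neg_right, hV, hW,
      inner_J_self]
    rw [inner_J_comm W V, inner_J_comm Z V, inner_J_comm Z W]
    ring

/-- Koszul's formula has a unique solution, so the vector picked by `Classical.epsilon` is the
explicit one. From here on the connection is handled through `lc`. -/
lemma leviCivita_eq {a : ℝ} (ha : 0 < a) {z : R4} (hz : z ∈ S3) {V W : R4}
    (hV : ⟪V, z⟫_ℝ = 0) (hW : ⟪W, z⟫_ℝ = 0) (W' : R4) :
    leviCivita (g a) z V W W' = lc a z V W W' :=
  (existsUnique_leviCivita ha hz V W W').unique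
    (Classical.epsilon_spec ⟨_, isLeviCivita_lc a hz hV hW W'⟩) (isLeviCivita_lc a hz hV hW W')

lemma eta0_add (z X Y : R4) : eta0 z (X + Y) = eta0 z X + eta0 z Y := by
  simp [eta0, inner_add_left]

lemma eta0_smul (z X : R4) (t : ℝ) : eta0 z (t • X) = t * eta0 z X := by
  simp [eta0, real_inner_smul_left]

/-! ### Curvature -/

lemma retr_mem {w : R4} (hw : w ≠ 0) : retr w ∈ S3 := by
  simp [S3, retr, norm_smul, hw]

lemma retr_of_mem {z : R4} (hz : z ∈ S3) : retr z = z := by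
  have h : ‖z‖ = 1 := by simpa [S3] using hz
  simp [retr, h]

lemma ne_zero_of_mem {z : R4} (hz : z ∈ S3) : z ≠ 0 := by
  rintro rfl; simp [S3] at hz

lemma differentiableAt_retr {z : R4} (hz : z ∈ S3) : DifferentiableAt ℝ retr z := by
  have h0 := ne_zero_of_mem hz
  exact ((differentiableAt_id.norm ℝ h0).inv (by simpa using h0)).smul differentiableAt_id

lemma fderiv_retr {z : R4} (hz : z ∈ S3) {v : R4} (hv : ⟪v, z⟫_ℝ = 0) :
    fderiv ℝ retr z v = v := by
  have h0 := ne_zero_of_mem hz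
  have h1 : ‖z‖ = 1 := by simpa [S3] using hz
  -- Writing the norm as the root of its square reduces its derivative to that of the squared norm.
  have hsq : HasFDerivAt (fun w : R4 => (√(‖w‖ ^ 2))⁻¹) _ z :=
    (hasDerivAt_inv (by simp [h0])).comp_hasFDerivAt z
      ((hasStrictFDerivAt_norm_sq z).hasFDerivAt.sqrt (by simp [h0]))
  have he : retr = fun w : R4 => (√(‖w‖ ^ 2))⁻¹ • w := by
    funext w; rw [Real.sqrt_sq (norm_nonneg _)]; rfl
  have hn := hsq.smul (hasFDerivAt_id z)
  have : fderiv ℝ retr z = _ := (congrArg (fun f => fderiv ℝ f z) he).trans hn.fderiv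
  rw [this]
  have hv' : ⟪z, v⟫_ℝ = 0 := by rw [real_inner_comm]; exact hv
  simp [h1, hv']

/-- Only the restriction of `Y` to the sphere enters `∇_X Y`. -/
lemma nabla_eq {a : ℝ} (ha : 0 < a) {z : R4} (hz : z ∈ S3) {X Y M : R4 → R4}
    (hYM : ∀ w ∈ S3, Y w = M w) (hX : ⟪X z, z⟫_ℝ = 0) (hM : ⟪M z, z⟫_ℝ = 0) {M' : R4 →L[ℝ] R4}
    (hd : HasFDerivAt M M' z) :
    nabla (g a) X Y z = lc a z (X z) (M z) (M' (X z)) := by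
  have hr := retr_of_mem hz
  have hc : HasFDerivAt (fun w => M (retr w)) (M'.comp (fderiv ℝ retr z)) z :=
    HasFDerivAt.comp z (by rw [hr]; exact hd) (differentiableAt_retr hz).hasFDerivAt
  have he : (fun w => Y (retr w)) =ᶠ[𝓝 z] fun w => M (retr w) := by
    filter_upwards [isOpen_ne.mem_nhds (ne_zero_of_mem hz)] with w hw
    exact hYM _ (retr_mem hw)
  have hf : fderiv ℝ (fun w => Y (retr w)) z (X z) = M' (X z) := by
    rw [he.fderiv_eq, hc.fderiv, ContinuousLinearMap.comp_apply, fderiv_retr hz hX]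
  simp only [nabla, covD, hf, hr, fderiv_retr hz hX]
  rw [hYM z hz]
  exact leviCivita_eq ha hz hX hM _

lemma inner_extend (X : R4) {z : R4} (hz : z ∈ S3) : ⟪extend X z, z⟫_ℝ = 0 := by
  simp only [extend, inner_sub_left, real_inner_smul_left, inner_self_of_mem hz]
  ring

lemma extend_of_inner {X z : R4} (h : ⟪X, z⟫_ℝ = 0) : extend X z = X := by
  simp [extend, h]

/-- Derivative of the projected constant field. -/
lemma hasFDerivAt_extend (X z : R4) : ∃ L : R4 →L[ℝ] R4, HasFDerivAt (extend X) L z ∧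
    ∀ V, L V = -(⟪X, V⟫_ℝ • z + ⟪X, z⟫_ℝ • V) := by
  have h : HasFDerivAt (fun w : R4 => X - ⟪X, w⟫_ℝ • w) _ z :=
    (((innerSL ℝ X).hasFDerivAt (x := z)).smul (hasFDerivAt_id z)).const_sub X
  refine ⟨_, h, fun V => ?_⟩
  simp [innerSL_apply_apply]
  abel

/-- `∇_Y Z` on the sphere, for the projections of the constant fields `Y`, `Z`. -/
def nablaExt (a : ℝ) (Y Z w : R4) : R4 :=
  -(⟪Z, w⟫_ℝ • extend Y w) + (1 - a) • (eta0 w Z • J (extend Y w) + eta0 w Y • J (extend Z w)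
    - (2 * eta0 w Y * eta0 w Z) • w)

lemma nabla_extend {a : ℝ} (ha : 0 < a) (Y Z : R4) {w : R4} (hw : w ∈ S3) :
    nabla (g a) (extend Y) (extend Z) w = nablaExt a Y Z w := by
  obtain ⟨L, hL, hLV⟩ := hasFDerivAt_extend Z w
  rw [nabla_eq ha hw (fun _ _ => rfl) (inner_extend Y hw) (inner_extend Z hw) hL, hLV]
  -- Projecting along w does not change η₀, because Jw is orthogonal to w.
  have h1 : ∀ X, eta0 w (extend X w) = eta0 w X := fun X => by
    simp [extend, eta0_eq, inner_sub_left, real_inner_smul_left, inner_J_self]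
  have hww := inner_self_of_mem hw
  simp only [lc, h1, nablaExt]
  simp only [inner_neg_left, inner_add_left, real_inner_smul_left, hww, inner_extend Y hw]
  module

/-- Derivative of `nablaExt a Y Z` at `z` in the direction `X`, for `X`, `Y`, `Z` tangent. -/
def nablaExtDeriv (a : ℝ) (z X Y Z : R4) : R4 :=
  -(⟪Z, X⟫_ℝ • Y) + (1 - a) • (eta0 X Z • J Y - (eta0 z Z * ⟪Y, X⟫_ℝ) • J z
    + eta0 X Y • J Z - (eta0 z Y * ⟪Z, X⟫_ℝ) • J z
    - (2 * (eta0 X Y * eta0 z Z + eta0 z Y * eta0 X Z)) • z - (2 * eta0 z Y * eta0 z Z) • X)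

lemma hasFDerivAt_eta0 (X z : R4) : ∃ L : R4 →L[ℝ] ℝ, HasFDerivAt (fun w => eta0 w X) L z ∧
    ∀ V, L V = eta0 V X := by
  have h : HasFDerivAt (fun w : R4 => -⟪X, Jcl w⟫_ℝ) _ z :=
    (((innerSL ℝ X).hasFDerivAt.comp z Jcl.hasFDerivAt)).neg
  simp only [eta0_eq]
  exact ⟨_, h, fun V => by simp [innerSL_apply_apply, Jcl_apply]⟩

lemma hasFDerivAt_nablaExt (a : ℝ) {z Y Z : R4} (hY : ⟪Y, z⟫_ℝ = 0) (hZ : ⟪Z, z⟫_ℝ = 0) :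
    ∃ L : R4 →L[ℝ] R4, HasFDerivAt (nablaExt a Y Z) L z ∧ ∀ X, L X = nablaExtDeriv a z X Y Z := by
  obtain ⟨LY, hLY, hLY'⟩ := hasFDerivAt_extend Y z
  obtain ⟨LZ, hLZ, hLZ'⟩ := hasFDerivAt_extend Z z
  obtain ⟨MY, hMY, hMY'⟩ := hasFDerivAt_eta0 Y z
  obtain ⟨MZ, hMZ, hMZ'⟩ := hasFDerivAt_eta0 Z z
  have h : HasFDerivAt (fun w => -(⟪Z, w⟫_ℝ • extend Y w) + (1 - a) • (eta0 w Z • Jcl (extend Y w)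
      + eta0 w Y • Jcl (extend Z w) - (2 * eta0 w Y * eta0 w Z) • w)) _ z :=
    ((((innerSL ℝ Z).hasFDerivAt (x := z)).smul hLY).neg).add
      ((((hMZ.smul (Jcl.hasFDerivAt.comp z hLY)).add (hMY.smul (Jcl.hasFDerivAt.comp z hLZ))).sub
        (((hMY.const_mul 2).mul hMZ).smul (hasFDerivAt_id z))).const_smul (1 - a))
  refine ⟨_, h, fun X => ?_⟩
  simp [innerSL_apply_apply, Jcl_apply, hLY', hLZ', hMY', hMZ', nablaExtDeriv, hY, hZ,
    extend_of_inner hY, extend_of_inner hZ, J_neg, J_smul]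
  module

/-- The curvature of `g a` in closed form. -/
def curv (a : ℝ) (z X Y Z : R4) : R4 :=
  lc a z X (nablaExt a Y Z z) (nablaExtDeriv a z X Y Z)
    - lc a z Y (nablaExt a X Z z) (nablaExtDeriv a z Y X Z)

/-- Tangency of the inner derivative is what allows `nabla_eq` to be applied a second time in the
curvature. -/
lemma inner_nablaExt (a : ℝ) {z Y Z : R4} (hz : z ∈ S3) :
    ⟪nablaExt a Y Z z, z⟫_ℝ = 0 := by
  have hzz := inner_self_of_mem hz
  simp only [nablaExt, inner_add_left, inner_neg_left, real_inner_smul_left, inner_sub_left,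
    inner_J_left, extend, eta0_eq, hzz, inner_J_self]
  ring

/-- On the sphere the inner derivatives are `nablaExt`, which `nabla_eq` differentiates again. For X
and Y tangent at z the derivatives of the projected constant fields are symmetric there, so the
bracket vanishes at z and the third term drops out. -/
lemma curvature_eq {a : ℝ} (ha : 0 < a) {z X Y Z : R4} (hz : z ∈ S3) (hX : ⟪X, z⟫_ℝ = 0)
    (hY : ⟪Y, z⟫_ℝ = 0) (hZ : ⟪Z, z⟫_ℝ = 0) :
    curvature (g a) z X Y Z = curv a z X Y Z := by
  obtain ⟨L, hL, hLV⟩ := hasFDerivAt_nablaExt a hY hZ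
  obtain ⟨K, hK, hKV⟩ := hasFDerivAt_nablaExt a hX hZ
  obtain ⟨LX, hLX, hLX'⟩ := hasFDerivAt_extend X z
  obtain ⟨LY, hLY, hLY'⟩ := hasFDerivAt_extend Y z
  obtain ⟨LZ, hLZ, hLZ'⟩ := hasFDerivAt_extend Z z
  have hr := retr_of_mem hz
  have hb : bracket (extend X) (extend Y) z = 0 := by
    have hc : ∀ {M : R4 → R4} {M' : R4 →L[ℝ] R4}, HasFDerivAt M M' z →
        HasFDerivAt (fun w => M (retr w)) (M'.comp (fderiv ℝ retr z)) z := fun hd =>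
      HasFDerivAt.comp z (by rw [hr]; exact hd) (differentiableAt_retr hz).hasFDerivAt
    simp only [bracket, VectorField.lieBracket, (hc hLX).fderiv, (hc hLY).fderiv, hr,
      extend_of_inner hX, extend_of_inner hY, ContinuousLinearMap.comp_apply, fderiv_retr hz hX,
      fderiv_retr hz hY, hLX', hLY', hX, hY, real_inner_comm X Y]
    module
  rw [curvature, nabla_eq ha hz (fun w hw => nabla_extend ha Y Z hw) (inner_extend X hz)
      (inner_nablaExt a hz) hL,
    nabla_eq ha hz (fun w hw => nabla_extend ha X Z hw) (inner_extend Y hz)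
      (inner_nablaExt a hz) hK,
    nabla_eq ha hz (fun w hw => rfl) (by rw [hb]; simp) (inner_extend Z hz) hLZ]
  simp only [hb, hLV, hKV, extend_of_inner hX, extend_of_inner hY, extend_of_inner hZ, curv,
    map_zero]
  simp [lc, eta0, J_zero]

/-- V and W' vary together because W' stands for the derivative of W in the direction V; in the
right-hand versions W and W' vary together. -/
lemma lc_add_left (a : ℝ) (z V₁ V₂ W W₁ W₂ : R4) :
    lc a z (V₁ + V₂) W (W₁ + W₂) = lc a z V₁ W W₁ + lc a z V₂ W W₂ := by
  simp only [lc, eta0_add, J_add, inner_add_left]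
  module

lemma lc_smul_left (a t : ℝ) (z V W W' : R4) :
    lc a z (t • V) W (t • W') = t • lc a z V W W' := by
  simp only [lc, eta0_smul, J_smul, real_inner_smul_left]
  module

lemma lc_add_right (a : ℝ) (z V W₁ W₂ X₁ X₂ : R4) :
    lc a z V (W₁ + W₂) (X₁ + X₂) = lc a z V W₁ X₁ + lc a z V W₂ X₂ := by
  simp only [lc, eta0_add, J_add, inner_add_left]
  module

lemma lc_smul_right (a t : ℝ) (z V W W' : R4) :
    lc a z V (t • W) (t • W') = t • lc a z V W W' := by
  simp only [lc, eta0_smul, J_smul, real_inner_smul_left]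
  module

lemma extend_add (X Y w : R4) : extend (X + Y) w = extend X w + extend Y w := by
  simp only [extend, inner_add_left]; module

lemma extend_smul (t : ℝ) (X w : R4) : extend (t • X) w = t • extend X w := by
  simp only [extend, real_inner_smul_left]; module

lemma nablaExt_add_left (a : ℝ) (X Y Z w : R4) :
    nablaExt a (X + Y) Z w = nablaExt a X Z w + nablaExt a Y Z w := by
  simp only [nablaExt, extend_add, eta0_add, J_add]; module

lemma nablaExt_smul_left (a t : ℝ) (Y Z w : R4) :
    nablaExt a (t • Y) Z w = t • nablaExt a Y Z w := by
  simp only [nablaExt, extend_smul, eta0_smul, J_smul]; module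

lemma nablaExt_add_right (a : ℝ) (X Y Z w : R4) :
    nablaExt a Z (X + Y) w = nablaExt a Z X w + nablaExt a Z Y w := by
  simp only [nablaExt, extend_add, eta0_add, J_add, inner_add_left]; module

lemma nablaExt_smul_right (a t : ℝ) (Y Z w : R4) :
    nablaExt a Y (t • Z) w = t • nablaExt a Y Z w := by
  simp only [nablaExt, extend_smul, eta0_smul, J_smul, real_inner_smul_left]; module

lemma eta0_add_left (z w X : R4) : eta0 (z + w) X = eta0 z X + eta0 w X := by
  simp only [eta0_eq, J_add, inner_add_right]; ring

lemma eta0_smul_left (t : ℝ) (z X : R4) : eta0 (t • z) X = t * eta0 z X := by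
  simp only [eta0_eq, J_smul, real_inner_smul_right]; ring

lemma nablaExtDeriv_add_left (a : ℝ) (z X₁ X₂ Y Z : R4) :
    nablaExtDeriv a z (X₁ + X₂) Y Z = nablaExtDeriv a z X₁ Y Z + nablaExtDeriv a z X₂ Y Z := by
  simp only [nablaExtDeriv, eta0_add_left, inner_add_right]; module

lemma nablaExtDeriv_smul_left (a t : ℝ) (z X Y Z : R4) :
    nablaExtDeriv a z (t • X) Y Z = t • nablaExtDeriv a z X Y Z := by
  simp only [nablaExtDeriv, eta0_smul_left, real_inner_smul_right]; module

lemma nablaExtDeriv_add_mid (a : ℝ) (z X Y₁ Y₂ Z : R4) :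
    nablaExtDeriv a z X (Y₁ + Y₂) Z = nablaExtDeriv a z X Y₁ Z + nablaExtDeriv a z X Y₂ Z := by
  simp only [nablaExtDeriv, eta0_add, inner_add_left, J_add]; module

lemma nablaExtDeriv_smul_mid (a t : ℝ) (z X Y Z : R4) :
    nablaExtDeriv a z X (t • Y) Z = t • nablaExtDeriv a z X Y Z := by
  simp only [nablaExtDeriv, eta0_smul, real_inner_smul_left, J_smul]; module

lemma nablaExtDeriv_add_right (a : ℝ) (z X Y Z₁ Z₂ : R4) :
    nablaExtDeriv a z X Y (Z₁ + Z₂) = nablaExtDeriv a z X Y Z₁ + nablaExtDeriv a z X Y Z₂ := by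
  simp only [nablaExtDeriv, eta0_add, inner_add_left, J_add]; module

lemma nablaExtDeriv_smul_right (a t : ℝ) (z X Y Z : R4) :
    nablaExtDeriv a z X Y (t • Z) = t • nablaExtDeriv a z X Y Z := by
  simp only [nablaExtDeriv, eta0_smul, real_inner_smul_left, J_smul]; module

/-- Linearity is needed only in the first and third slots, which the differential fills in the
curvature trace of the bitension. -/
lemma curv_add_left (a : ℝ) (z X₁ X₂ Y Z : R4) :
    curv a z (X₁ + X₂) Y Z = curv a z X₁ Y Z + curv a z X₂ Y Z := by
  simp only [curv, nablaExt_add_left, nablaExtDeriv_add_left, nablaExtDeriv_add_mid, lc_add_left,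
    lc_add_right]
  abel

lemma curv_smul_left (a t : ℝ) (z X Y Z : R4) :
    curv a z (t • X) Y Z = t • curv a z X Y Z := by
  simp only [curv, nablaExt_smul_left, nablaExtDeriv_smul_left, nablaExtDeriv_smul_mid,
    lc_smul_left, lc_smul_right, smul_sub]

lemma curv_add_right (a : ℝ) (z X Y Z₁ Z₂ : R4) :
    curv a z X Y (Z₁ + Z₂) = curv a z X Y Z₁ + curv a z X Y Z₂ := by
  simp only [curv, nablaExt_add_right, nablaExtDeriv_add_right, lc_add_right]
  abel

lemma curv_smul_right (a t : ℝ) (z X Y Z : R4) :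
    curv a z X Y (t • Z) = t • curv a z X Y Z := by
  simp only [curv, nablaExt_smul_right, nablaExtDeriv_smul_right, lc_smul_right, smul_sub]

/-- The Ricci curvature of `g a` in a horizontal direction `JT` is `4 / a - 2`. -/
lemma curv_trace {a : ℝ} (ha : 0 < a) {z T : R4} (hz : z ∈ S3) (hT : ⟪T, z⟫_ℝ = 0)
    (hTJ : ⟪T, J z⟫_ℝ = 0) (hTT : a * ⟪T, T⟫_ℝ = 1) (k : ℝ) :
    curv a z T (k • J T) T + curv a z (-(1 / a) • J z) (k • J T) (-(1 / a) • J z) =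
      -((k * (4 / a - 2)) • J T) := by
  have hzz := inner_self_of_mem hz
  have hTT' : ⟪T, T⟫_ℝ = 1 / a := by field_simp; linarith
  have hzT : ⟪z, T⟫_ℝ = 0 := by rw [real_inner_comm]; exact hT
  have hzJT : ⟪z, J T⟫_ℝ = 0 := by rw [inner_J_comm, hTJ, neg_zero]
  simp only [curv, lc, nablaExt, nablaExtDeriv, extend, eta0_eq, inner_add_left, inner_neg_left,
    inner_sub_left, real_inner_smul_left, inner_neg_right,
    real_inner_smul_right, J_add, J_smul, J_neg, J_sub, J_J, inner_J_left,
    inner_J_self, hzz, hTT', hT, hTJ, hzT, hzJT]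
  match_scalars <;> field_simp <;> ring

/-! ### Change of coordinates for the tension and bitension fields -/

/-- For the Leibniz rule: the derivative of a coefficient times a tangent field is tangent, and
passes through the connection unchanged. -/
lemma lc_add_tangent (a : ℝ) {z D : R4} (hD : ⟪D, z⟫_ℝ = 0) (V W W' : R4) :
    lc a z V W (W' + D) = lc a z V W W' + D := by
  simp only [lc, inner_add_left, hD]
  module

lemma fderiv_eq_sum_pd {E : Type*} [NormedAddCommGroup E] [NormedSpace ℝ E] (f : R2 → E)
    (p v : R2) : fderiv ℝ f p v = ∑ m, v m • pd m f p := by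
  conv_lhs => rw [← Finset.univ_sum_single v, map_sum]
  refine Finset.sum_congr rfl fun m _ => ?_
  rw [pd, ← map_smul, ← Pi.single_smul, smul_eq_mul, mul_one]

lemma pd_congr {E : Type*} [NormedAddCommGroup E] [NormedSpace ℝ E] {f h : R2 → E} {p : R2}
    (hfh : f =ᶠ[𝓝 p] h) (i : Fin 2) : pd i f p = pd i h p := by
  simp only [pd, hfh.fderiv_eq]

/-- The Jacobian matrix of a map of the plane. -/
def jac (φ : R2 → R2) (q : R2) : Matrix (Fin 2) (Fin 2) ℝ :=
  Matrix.of fun m i => pd i (fun q => φ q m) q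

lemma pd_comp {E : Type*} [NormedAddCommGroup E] [NormedSpace ℝ E] {f : R2 → E} {φ : R2 → R2}
    {p : R2} (hf : DifferentiableAt ℝ f (φ p)) (hφ : DifferentiableAt ℝ φ p) (i : Fin 2) :
    pd i (fun q => f (φ q)) p = ∑ m, jac φ p m i • pd m f (φ p) := by
  have h : fderiv ℝ (fun q => f (φ q)) p = _ := (hf.hasFDerivAt.comp p hφ.hasFDerivAt).fderiv
  rw [pd, h, ContinuousLinearMap.comp_apply, fderiv_eq_sum_pd f]
  refine Finset.sum_congr rfl fun m _ => ?_
  congr 1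
  have := (hasFDerivAt_pi'.1 hφ.hasFDerivAt m).fderiv
  simp only [jac, pd, Matrix.of_apply, this]
  rfl

lemma contDiffOn_pd {E : Type*} [NormedAddCommGroup E] [NormedSpace ℝ E] {f : R2 → E}
    {U : Set R2} (hU : IsOpen U) (hf : ContDiffOn ℝ ∞ f U) (i : Fin 2) :
    ContDiffOn ℝ ∞ (pd i f) U :=
  (hf.fderiv_of_isOpen hU (by simp)).clm_apply contDiffOn_const

lemma pd_comm {f : R2 → ℝ} {U : Set R2} (hU : IsOpen U) (hf : ContDiffOn ℝ ∞ f U) {p : R2}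
    (hp : p ∈ U) (i j : Fin 2) : pd i (pd j f) p = pd j (pd i f) p := by
  have hc : ContDiffAt ℝ ∞ f p := hf.contDiffAt (hU.mem_nhds hp)
  have hd : DifferentiableAt ℝ (fderiv ℝ f) p :=
    ((hf.fderiv_of_isOpen (m := ∞) hU (by simp)).contDiffAt (hU.mem_nhds hp)).differentiableAt
      (by simp)
  have hs := (hc.isSymmSndFDerivAt (by simpa using WithTop.coe_le_coe.2 (le_top : (2 : ℕ∞) ≤ ⊤))).eq
  have key : ∀ i j : Fin 2, pd i (pd j f) p =
      fderiv ℝ (fderiv ℝ f) p (Pi.single i 1) (Pi.single j 1) := fun i j => by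
    have h : HasFDerivAt (pd j f) _ p := hd.hasFDerivAt.clm_apply (hasFDerivAt_const _ p)
    rw [pd, h.fderiv]
    simp
  rw [key, key, hs]

lemma inner_pd_of_mem {Φ : R2 → R4} {V : Set R2} (hV : IsOpen V) (hΦ : ∀ q ∈ V, Φ q ∈ S3)
    {q : R2} (hq : q ∈ V) (hd : DifferentiableAt ℝ Φ q) (i : Fin 2) : ⟪pd i Φ q, Φ q⟫_ℝ = 0 := by
  have h1 : (fun q => ⟪Φ q, Φ q⟫_ℝ) =ᶠ[𝓝 q] fun _ => (1 : ℝ) := by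
    filter_upwards [hV.mem_nhds hq] with r hr using inner_self_of_mem (hΦ r hr)
  have h2 := h1.fderiv_eq.symm.trans (hd.hasFDerivAt.inner ℝ hd.hasFDerivAt).fderiv
  have h3 := DFunLike.congr_fun h2 (Pi.single i 1)
  simp [real_inner_comm (Φ q)] at h3
  rw [pd, real_inner_comm]
  linarith

/-- Trace of the covariant derivative of a form `Y` with values in the fields along `F`. -/
def divForm (h : R4 → R4 → R4 → ℝ) (F : R2 → R4) (Y : Fin 2 → R2 → R4) (p : R2) : R4 :=
  ∑ i, ∑ j, (indMetric h F p)⁻¹ i j •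
    (cd h F i (Y j) p - ∑ k, christoffel (indMetric h F) k i j p • Y k p)

/-- `F = Φ ∘ φ` on `U`, where `Φ` is a parametrization by flat orthonormal coordinates. -/
structure IsFlatFactor (a : ℝ) (V : Set R2) (Φ : R2 → R4) (U : Set R2) (F : R2 → R4)
    (φ : R2 → R2) : Prop where
  isOpen_target : IsOpen V
  smooth : ContDiffOn ℝ ∞ Φ V
  mem : ∀ q ∈ V, Φ q ∈ S3
  flat : ∀ q ∈ V, indMetric (g a) Φ q = 1
  isOpen_source : IsOpen U
  smooth_coord : ContDiffOn ℝ ∞ φ U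
  mapsTo : ∀ p ∈ U, φ p ∈ V
  eq : ∀ p ∈ U, F p = Φ (φ p)
  injective : ∀ p ∈ U, Function.Injective (fderiv ℝ F p)

/-! ### Independence of the traces from the coordinates -/

namespace IsFlatFactor

variable {a : ℝ} {V : Set R2} {Φ : R2 → R4} {U : Set R2} {F : R2 → R4} {φ : R2 → R2}

lemma eventuallyEq (H : IsFlatFactor a V Φ U F φ) {p : R2} (hp : p ∈ U) :
    F =ᶠ[𝓝 p] fun q => Φ (φ q) := by
  filter_upwards [H.isOpen_source.mem_nhds hp] with q hq using H.eq q hq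

lemma differentiableAt (H : IsFlatFactor a V Φ U F φ) {q : R2} (hq : q ∈ V) :
    DifferentiableAt ℝ Φ q :=
  (H.smooth.contDiffAt (H.isOpen_target.mem_nhds hq)).differentiableAt (by simp)

lemma differentiableAt_coord (H : IsFlatFactor a V Φ U F φ) {p : R2} (hp : p ∈ U) :
    DifferentiableAt ℝ φ p :=
  (H.smooth_coord.contDiffAt (H.isOpen_source.mem_nhds hp)).differentiableAt (by simp)

lemma pd_eq (H : IsFlatFactor a V Φ U F φ) {p : R2} (hp : p ∈ U) (i : Fin 2) :
    pd i F p = ∑ m, jac φ p m i • pd m Φ (φ p) := by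
  rw [pd_congr (H.eventuallyEq hp),
    pd_comp (H.differentiableAt (H.mapsTo p hp)) (H.differentiableAt_coord hp)]

lemma inner_pd (H : IsFlatFactor a V Φ U F φ) {q : R2} (hq : q ∈ V) (m : Fin 2) :
    ⟪pd m Φ q, Φ q⟫_ℝ = 0 :=
  inner_pd_of_mem H.isOpen_target H.mem hq (H.differentiableAt hq) m

lemma contDiffOn_comp (H : IsFlatFactor a V Φ U F φ) (m : Fin 2) :
    ContDiffOn ℝ ∞ (fun q => φ q m) U := contDiffOn_pi.1 H.smooth_coord m

lemma differentiableAt_jac (H : IsFlatFactor a V Φ U F φ) {p : R2} (hp : p ∈ U) (m i : Fin 2) :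
    DifferentiableAt ℝ (fun q => jac φ q m i) p :=
  ((contDiffOn_pd H.isOpen_source (H.contDiffOn_comp m) i).contDiffAt
    (H.isOpen_source.mem_nhds hp)).differentiableAt (by simp)

/-- A kernel vector of the Jacobian would also be one of the derivative of F. -/
lemma isUnit_det_jac (H : IsFlatFactor a V Φ U F φ) {p : R2} (hp : p ∈ U) :
    IsUnit (jac φ p).det := by
  rw [isUnit_iff_ne_zero]
  intro h0
  obtain ⟨v, hv, hv0⟩ := Matrix.exists_mulVec_eq_zero_iff.2 h0
  apply hv
  apply H.injective p hp
  rw [map_zero, fderiv_eq_sum_pd]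
  have e0 := congrFun hv0 0
  have e1 := congrFun hv0 1
  simp only [Matrix.mulVec, dotProduct, Fin.sum_univ_two, Pi.zero_apply] at e0 e1
  simp only [H.pd_eq hp, Fin.sum_univ_two]
  have : v 0 • (jac φ p 0 0 • pd 0 Φ (φ p) + jac φ p 1 0 • pd 1 Φ (φ p)) +
      v 1 • (jac φ p 0 1 • pd 0 Φ (φ p) + jac φ p 1 1 • pd 1 Φ (φ p)) =
      (jac φ p 0 0 * v 0 + jac φ p 0 1 * v 1) • pd 0 Φ (φ p) +
      (jac φ p 1 0 * v 0 + jac φ p 1 1 * v 1) • pd 1 Φ (φ p) := by module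
  rw [this, e0, e1]
  simp

lemma indMetric_eq (H : IsFlatFactor a V Φ U F φ) {p : R2} (hp : p ∈ U) :
    indMetric (g a) F p = (jac φ p).transpose * jac φ p := by
  have hf := H.flat _ (H.mapsTo p hp)
  have h : ∀ m n, g a (Φ (φ p)) (pd m Φ (φ p)) (pd n Φ (φ p)) = (1 : Matrix _ _ ℝ) m n :=
    fun m n => congrFun (congrFun hf m) n
  ext i j
  simp only [indMetric, Matrix.of_apply, H.pd_eq hp, H.eq p hp, Matrix.mul_apply,
    Matrix.transpose_apply]
  have h00 := h 0 0
  have h01 := h 0 1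
  have h10 := h 1 0
  have h11 := h 1 1
  simp only [Matrix.one_apply_eq, Matrix.one_apply_ne (show (0 : Fin 2) ≠ 1 by decide),
    Matrix.one_apply_ne (show (1 : Fin 2) ≠ 0 by decide), g] at h00 h01 h10 h11
  simp only [Fin.sum_univ_two, g, inner_add_left, inner_add_right, real_inner_smul_left,
    real_inner_smul_right, eta0_add, eta0_smul]
  linear_combination (jac φ p 0 i * jac φ p 0 j) * h00 + (jac φ p 0 i * jac φ p 1 j) * h01 +
    (jac φ p 1 i * jac φ p 0 j) * h10 + (jac φ p 1 i * jac φ p 1 j) * h11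

lemma inv_mul_transpose (H : IsFlatFactor a V Φ U F φ) {p : R2} (hp : p ∈ U) :
    (indMetric (g a) F p)⁻¹ * (jac φ p).transpose = (jac φ p)⁻¹ := by
  have hu : IsUnit (jac φ p).transpose.det := by
    rw [Matrix.det_transpose]; exact H.isUnit_det_jac hp
  rw [H.indMetric_eq hp, Matrix.mul_inv_rev, Matrix.mul_assoc, Matrix.nonsing_inv_mul _ hu,
    Matrix.mul_one]

lemma sum_inv_jac_jac (H : IsFlatFactor a V Φ U F φ) {p : R2} (hp : p ∈ U) :
    jac φ p * ((indMetric (g a) F p)⁻¹ * (jac φ p).transpose) = 1 := by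
  rw [H.inv_mul_transpose hp, Matrix.mul_nonsing_inv _ (H.isUnit_det_jac hp)]

/-- Christoffel symbols vanish in flat coordinates, so those of the pulled-back metric are the
inverse Jacobian applied to the second derivatives of the coordinate change. -/
lemma sum_christoffel (H : IsFlatFactor a V Φ U F φ) {p : R2} (hp : p ∈ U) (m i j : Fin 2) :
    ∑ k, christoffel (indMetric (g a) F) k i j p * jac φ p m k =
      pd i (fun q => jac φ q m j) p := by
  have hG : ∀ i j l, pd i (fun q => indMetric (g a) F q j l) p =
      ∑ n, (pd i (fun q => jac φ q n j) p * jac φ p n l +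
        jac φ p n j * pd i (fun q => jac φ q n l) p) := fun i j l => by
    have he : (fun q => indMetric (g a) F q j l) =ᶠ[𝓝 p]
        fun q => jac φ q 0 j * jac φ q 0 l + jac φ q 1 j * jac φ q 1 l := by
      filter_upwards [H.isOpen_source.mem_nhds hp] with q hq
      rw [H.indMetric_eq hq, Matrix.mul_apply, Fin.sum_univ_two]
      rfl
    have hd := fun m i => (H.differentiableAt_jac hp m i).hasFDerivAt
    have h2 := (((hd 0 j).mul (hd 0 l)).add ((hd 1 j).mul (hd 1 l))).fderiv
    rw [pd_congr he, pd]
    refine (congrArg (fun L => L (Pi.single i 1)) h2).trans ?_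
    simp [Fin.sum_univ_two, pd]
    ring
  have hs : ∀ n i j, pd i (fun q => jac φ q n j) p = pd j (fun q => jac φ q n i) p :=
    fun n i j => pd_comm H.isOpen_source (H.contDiffOn_comp n) hp i j
  have hc : ∀ k, christoffel (indMetric (g a) F) k i j p =
      ∑ n, (jac φ p)⁻¹ k n * pd i (fun q => jac φ q n j) p := fun k => by
    rw [← H.inv_mul_transpose hp]
    simp only [christoffel, hG, Matrix.mul_apply, Matrix.transpose_apply, Fin.sum_univ_two]
    -- Once mixed partials are in one order, four of the six product-rule terms cancel in pairs and
    -- the other two coincide, which absorbs the factor 1/2.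
    rw [hs 0 j i, hs 1 j i, hs 0 0 i, hs 1 0 i, hs 0 1 i, hs 1 1 i, hs 0 0 j, hs 1 0 j, hs 0 1 j,
      hs 1 1 j]
    ring
  have h1 := Matrix.mul_nonsing_inv _ (H.isUnit_det_jac hp)
  have h2 : ∀ n, ∑ k, jac φ p m k * (jac φ p)⁻¹ k n = (1 : Matrix _ _ ℝ) m n := fun n => by
    rw [← h1, Matrix.mul_apply]
  simp only [hc]
  have e0 := h2 0
  have e1 := h2 1
  simp only [Fin.sum_univ_two] at e0 e1 ⊢
  have e2 : ∀ m, (1 : Matrix (Fin 2) (Fin 2) ℝ) m 0 * pd i (fun q => jac φ q 0 j) p +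
      (1 : Matrix (Fin 2) (Fin 2) ℝ) m 1 * pd i (fun q => jac φ q 1 j) p =
      pd i (fun q => jac φ q m j) p := Fin.forall_fin_two.2 ⟨by simp, by simp⟩
  linear_combination e2 m + pd i (fun q => jac φ q 0 j) p * e0 + pd i (fun q => jac φ q 1 j) p * e1

lemma cd_eq_lc (H : IsFlatFactor a V Φ U F φ) (ha : 0 < a) {q : R2} (hq : q ∈ V) (m : Fin 2)
    {X : R2 → R4} (hX : ⟪X q, Φ q⟫_ℝ = 0) :
    cd (g a) Φ m X q = lc a (Φ q) (pd m Φ q) (X q) (pd m X q) :=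
  leviCivita_eq ha (H.mem q hq) (H.inner_pd hq m) hX _

lemma inner_pd_source (H : IsFlatFactor a V Φ U F φ) {p : R2} (hp : p ∈ U) (i : Fin 2) :
    ⟪pd i F p, F p⟫_ℝ = 0 := by
  rw [H.pd_eq hp, H.eq p hp]
  simp [Fin.sum_univ_two, inner_add_left, real_inner_smul_left, H.inner_pd (H.mapsTo p hp)]

lemma cd_comp (H : IsFlatFactor a V Φ U F φ) (ha : 0 < a) {p : R2} (hp : p ∈ U) (i : Fin 2)
    {X Y : R2 → R4} (hX : ⟪X (φ p), Φ (φ p)⟫_ℝ = 0) (hXd : DifferentiableAt ℝ X (φ p))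
    (hY : Y =ᶠ[𝓝 p] fun q => X (φ q)) :
    cd (g a) F i Y p = ∑ m, jac φ p m i • cd (g a) Φ m X (φ p) := by
  have hq := H.mapsTo p hp
  have hYp : Y p = X (φ p) := hY.eq_of_nhds
  simp only [H.cd_eq_lc ha hq _ hX]
  have h1 : cd (g a) F i Y p = lc a (F p) (pd i F p) (Y p) (pd i Y p) :=
    leviCivita_eq ha (by rw [H.eq p hp]; exact H.mem _ hq) (H.inner_pd_source hp i)
      (by rw [hYp, H.eq p hp]; exact hX) _
  rw [h1, H.pd_eq hp, H.eq p hp, hYp, pd_congr hY, pd_comp hXd (H.differentiableAt_coord hp)]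
  simp only [Fin.sum_univ_two, lc_add_left, lc_smul_left]

/-- Y is the pull-back of the form X. The second derivatives of the coordinate change coming from
the product rule are exactly those removed by the Christoffel term, and in what remains the inverse
metric contracts two Jacobians to the identity. It serves for the tension, with X the differential
of Φ, and for the rough Laplacian, with X the covariant derivative of the tension. -/
lemma divForm_eq (H : IsFlatFactor a V Φ U F φ) (ha : 0 < a) {p : R2} (hp : p ∈ U)
    {X Y : Fin 2 → R2 → R4} (hX : ∀ n, ⟪X n (φ p), Φ (φ p)⟫_ℝ = 0)
    (hXd : ∀ n, DifferentiableAt ℝ (X n) (φ p))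
    (hY : ∀ j, Y j =ᶠ[𝓝 p] fun q => ∑ n, jac φ q n j • X n (φ q)) :
    divForm (g a) F Y p = ∑ m, cd (g a) Φ m (X m) (φ p) := by
  have hq := H.mapsTo p hp
  have hYp : ∀ j, Y j p = ∑ n, jac φ p n j • X n (φ p) := fun j => (hY j).eq_of_nhds
  have hYt : ∀ j, ⟪Y j p, F p⟫_ℝ = 0 := fun j => by
    rw [hYp, H.eq p hp]
    simp [Fin.sum_univ_two, inner_add_left, real_inner_smul_left, hX]
  have hYd : ∀ i j, pd i (Y j) p = (∑ n, jac φ p n j • pd i (fun q => X n (φ q)) p) +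
      ∑ n, pd i (fun q => jac φ q n j) p • X n (φ p) := fun i j => by
    have hd := fun m i => (H.differentiableAt_jac hp m i).hasFDerivAt
    have hx := fun n => ((hXd n).comp p (H.differentiableAt_coord hp)).hasFDerivAt
    have h2 : fderiv ℝ (fun q => jac φ q 0 j • X 0 (φ q) + jac φ q 1 j • X 1 (φ q)) p = _ :=
      (((hd 0 j).smul (hx 0)).add ((hd 1 j).smul (hx 1))).fderiv
    simp only [Fin.sum_univ_two] at hY
    rw [pd_congr (hY j), pd, h2]
    simp [Fin.sum_univ_two, pd, Function.comp_def]
    abel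
  have hcd : ∀ i j, cd (g a) F i (Y j) p =
      (∑ n, ∑ m, (jac φ p n j * jac φ p m i) • cd (g a) Φ m (X n) (φ p)) +
        ∑ n, pd i (fun q => jac φ q n j) p • X n (φ p) := fun i j => by
    have h1 : cd (g a) F i (Y j) p = lc a (F p) (pd i F p) (Y j p) (pd i (Y j) p) :=
      leviCivita_eq ha (by rw [H.eq p hp]; exact H.mem _ hq) (H.inner_pd_source hp i) (hYt j) _
    have h2 : ∀ n, ∑ m, jac φ p m i • cd (g a) Φ m (X n) (φ p) =
        lc a (F p) (pd i F p) (X n (φ p)) (pd i (fun q => X n (φ q)) p) := fun n => by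
      rw [← H.cd_comp ha hp i (hX n) (hXd n) (Y := fun q => X n (φ q)) (Filter.EventuallyEq.refl _ _)]
      exact leviCivita_eq ha (by rw [H.eq p hp]; exact H.mem _ hq) (H.inner_pd_source hp i)
        (by simpa [H.eq p hp] using hX n) _
    have ht : ⟪∑ n, pd i (fun q => jac φ q n j) p • X n (φ p), F p⟫_ℝ = 0 := by
      rw [H.eq p hp]
      simp [Fin.sum_univ_two, inner_add_left, real_inner_smul_left, hX]
    rw [h1, hYd, lc_add_tangent a ht, hYp]
    simp only [mul_smul, ← Finset.smul_sum, h2]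
    congr 1
    simp only [Fin.sum_univ_two, lc_add_right, lc_smul_right]
  have hsub : ∀ i j, cd (g a) F i (Y j) p -
      ∑ k, christoffel (indMetric (g a) F) k i j p • Y k p =
      ∑ n, ∑ m, (jac φ p n j * jac φ p m i) • cd (g a) Φ m (X n) (φ p) := fun i j => by
    rw [hcd]
    have e0 := H.sum_christoffel hp 0 i j
    have e1 := H.sum_christoffel hp 1 i j
    simp only [hYp, Fin.sum_univ_two] at e0 e1 ⊢
    rw [← e0, ← e1]
    module
  have hM := H.sum_inv_jac_jac hp
  have hM' : ∀ m n, ∑ i, ∑ j, (indMetric (g a) F p)⁻¹ i j * (jac φ p n j * jac φ p m i) =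
      (1 : Matrix _ _ ℝ) m n := fun m n => by
    rw [← hM]
    simp only [Matrix.mul_apply, Matrix.transpose_apply, Fin.sum_univ_two]
    ring
  simp only [divForm, hsub]
  have e00 := hM' 0 0
  have e01 := hM' 0 1
  have e10 := hM' 1 0
  have e11 := hM' 1 1
  simp only [Matrix.one_apply_eq, Matrix.one_apply_ne (show (0 : Fin 2) ≠ 1 by decide),
    Matrix.one_apply_ne (show (1 : Fin 2) ≠ 0 by decide), Fin.sum_univ_two] at e00 e01 e10 e11 ⊢
  generalize cd (g a) Φ 0 (X 0) (φ p) = C00 at *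
  generalize cd (g a) Φ 0 (X 1) (φ p) = C01 at *
  generalize cd (g a) Φ 1 (X 0) (φ p) = C10 at *
  generalize cd (g a) Φ 1 (X 1) (φ p) = C11 at *
  linear_combination (norm := module) e00 • C00 + e01 • C01 + e10 • C10 + e11 • C11

lemma tension_eq (H : IsFlatFactor a V Φ U F φ) (ha : 0 < a) {p : R2} (hp : p ∈ U) :
    tension (g a) F p = ∑ m, cd (g a) Φ m (pd m Φ) (φ p) := by
  refine H.divForm_eq ha hp (X := fun m => pd m Φ) (Y := fun m => pd m F)
    (H.inner_pd (H.mapsTo p hp)) (fun n => ?_) (fun j => ?_)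
  · exact ((contDiffOn_pd H.isOpen_target H.smooth n).contDiffAt
      (H.isOpen_target.mem_nhds (H.mapsTo p hp))).differentiableAt (by simp)
  · filter_upwards [H.isOpen_source.mem_nhds hp] with q hq using H.pd_eq hq j

/-- T and D are closed forms for the tension and its covariant derivatives. They are required on all
of V because both are differentiated once more. -/
lemma bitension_eq (H : IsFlatFactor a V Φ U F φ) (ha : 0 < a) {T : R2 → R4}
    {D : Fin 2 → R2 → R4} (hT : ∀ q ∈ V, ∑ m, cd (g a) Φ m (pd m Φ) q = T q)
    (hTd : ∀ q ∈ V, DifferentiableAt ℝ T q) (hTt : ∀ q ∈ V, ⟪T q, Φ q⟫_ℝ = 0)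
    (hD : ∀ n, ∀ q ∈ V, cd (g a) Φ n T q = D n q)
    (hDd : ∀ n, ∀ q ∈ V, DifferentiableAt ℝ (D n) q) (hDt : ∀ n, ∀ q ∈ V, ⟪D n q, Φ q⟫_ℝ = 0)
    {p : R2} (hp : p ∈ U) :
    bitension (g a) F p = ∑ m, cd (g a) Φ m (D m) (φ p) -
      ∑ m, curv a (Φ (φ p)) (pd m Φ (φ p)) (T (φ p)) (pd m Φ (φ p)) := by
  have hq := H.mapsTo p hp
  have ht : ∀ r ∈ U, tension (g a) F r = T (φ r) := fun r hr => by
    rw [H.tension_eq ha hr, hT _ (H.mapsTo r hr)]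
  have h1 : traceHess (g a) F (tension (g a) F) p = ∑ m, cd (g a) Φ m (D m) (φ p) := by
    refine H.divForm_eq ha hp (X := D) (Y := fun j => cd (g a) F j (tension (g a) F))
      (fun n => hDt n _ hq) (fun n => hDd n _ hq) (fun j => ?_)
    filter_upwards [H.isOpen_source.mem_nhds hp] with r hr
    have hr' := H.mapsTo r hr
    rw [H.cd_comp ha hr j (hTt _ hr') (hTd _ hr')
      (by filter_upwards [H.isOpen_source.mem_nhds hr] with s hs using ht s hs)]
    simp only [hD _ _ hr']
  have hM := H.sum_inv_jac_jac hp
  have hM' : ∀ m n, ∑ i, ∑ j, (indMetric (g a) F p)⁻¹ i j * (jac φ p n j * jac φ p m i) =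
      (1 : Matrix _ _ ℝ) m n := fun m n => by
    rw [← hM]
    simp only [Matrix.mul_apply, Matrix.transpose_apply, Fin.sum_univ_two]
    ring
  have hc : ∀ i j, curvature (g a) (F p) (pd i F p) (tension (g a) F p) (pd j F p) =
      curv a (F p) (pd i F p) (tension (g a) F p) (pd j F p) := fun i j => by
    refine curvature_eq ha (by rw [H.eq p hp]; exact H.mem _ hq) (H.inner_pd_source hp i) ?_
      (H.inner_pd_source hp j)
    rw [ht p hp, H.eq p hp]; exact hTt _ hq
  rw [bitension, h1]
  congr 1
  simp only [hc]
  simp only [H.pd_eq hp, ht p hp, H.eq p hp]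
  have e00 := hM' 0 0
  have e01 := hM' 0 1
  have e10 := hM' 1 0
  have e11 := hM' 1 1
  simp only [Matrix.one_apply_eq, Matrix.one_apply_ne (show (0 : Fin 2) ≠ 1 by decide),
    Matrix.one_apply_ne (show (1 : Fin 2) ≠ 0 by decide), Fin.sum_univ_two] at e00 e01 e10 e11 ⊢
  simp only [curv_add_left, curv_smul_left, curv_add_right, curv_smul_right]
  generalize curv a (Φ (φ p)) (pd 0 Φ (φ p)) (T (φ p)) (pd 0 Φ (φ p)) = C00 at *
  generalize curv a (Φ (φ p)) (pd 0 Φ (φ p)) (T (φ p)) (pd 1 Φ (φ p)) = C01 at *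
  generalize curv a (Φ (φ p)) (pd 1 Φ (φ p)) (T (φ p)) (pd 0 Φ (φ p)) = C10 at *
  generalize curv a (Φ (φ p)) (pd 1 Φ (φ p)) (T (φ p)) (pd 1 Φ (φ p)) = C11 at *
  linear_combination (norm := module) e00 • C00 + e01 • C01 + e10 • C10 + e11 • C11

end IsFlatFactor

/-! ### Rotations and orbits -/

/-- The flow of `-J`. -/
def rot (θ : ℝ) (z : R4) : R4 := Real.cos θ • z - Real.sin θ • J z

lemma rot_zero (z : R4) : rot 0 z = z := by simp [rot]

lemma rot_add (s t : ℝ) (z : R4) : rot (s + t) z = rot s (rot t z) := by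
  simp only [rot, Real.cos_add, Real.sin_add, J_sub, J_smul, J_J]
  module

lemma rot_neg_rot (θ : ℝ) (z : R4) : rot (-θ) (rot θ z) = z := by
  rw [← rot_add, neg_add_cancel, rot_zero]

lemma rot_rot_neg (θ : ℝ) (z : R4) : rot θ (rot (-θ) z) = z := by
  rw [← rot_add, add_neg_cancel, rot_zero]

lemma rot_vadd (θ : ℝ) (x y : R4) : rot θ (x + y) = rot θ x + rot θ y := by
  simp only [rot, J_add]; module

lemma rot_vsub (θ : ℝ) (x y : R4) : rot θ (x - y) = rot θ x - rot θ y := by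
  simp only [rot, J_sub]; module

lemma rot_smul (θ t : ℝ) (x : R4) : rot θ (t • x) = t • rot θ x := by
  simp only [rot, J_smul]; module

lemma rot_neg (θ : ℝ) (x : R4) : rot θ (-x) = -rot θ x := by
  simp only [rot, J_neg]; module

lemma rot_vzero (θ : ℝ) : rot θ 0 = 0 := by
  simp [rot, J_zero]

lemma rot_J (θ : ℝ) (x : R4) : rot θ (J x) = J (rot θ x) := by
  simp only [rot, J_sub, J_smul]

lemma inner_rot_rot (θ : ℝ) (x y : R4) : ⟪rot θ x, rot θ y⟫_ℝ = ⟪x, y⟫_ℝ := by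
  simp only [rot, inner_sub_left, inner_sub_right, real_inner_smul_left, real_inner_smul_right,
    inner_J_left, J_J, inner_neg_right]
  linear_combination ⟪x, y⟫_ℝ * Real.cos_sq_add_sin_sq θ

lemma inner_rot_J_rot (θ : ℝ) (x y : R4) : ⟪rot θ x, J (rot θ y)⟫_ℝ = ⟪x, J y⟫_ℝ := by
  rw [← rot_J, inner_rot_rot]

lemma rot_mem (θ : ℝ) {z : R4} (hz : z ∈ S3) : rot θ z ∈ S3 :=
  mem_of_inner_self (by rw [inner_rot_rot, inner_self_of_mem hz])

lemma rot_injective (θ : ℝ) : Function.Injective (rot θ) := fun x y h => by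
  rw [← rot_neg_rot θ x, h, rot_neg_rot]

lemma eta0_rot (θ : ℝ) (z X : R4) : eta0 (rot θ z) (rot θ X) = eta0 z X := by
  rw [eta0_eq, eta0_eq, inner_rot_J_rot]

/-- Rotations preserve the inner product and commute with J, hence are isometries of `g a`. This
removes the fibre coordinate from the computations on the tube. -/
lemma lc_rot (a θ : ℝ) (z V W W' : R4) :
    lc a (rot θ z) (rot θ V) (rot θ W) (rot θ W') = rot θ (lc a z V W W') := by
  simp only [lc, eta0_rot, inner_rot_rot, rot_vadd, rot_vsub, rot_smul, rot_J]

lemma hasDerivAt_J {w : ℝ → R4} {w' : R4} {t : ℝ} (hw : HasDerivAt w w' t) :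
    HasDerivAt (fun t => J (w t)) (J w') t :=
  Jcl.hasFDerivAt.comp_hasDerivAt t hw

lemma hasDerivAt_rot {θ : ℝ → ℝ} {w : ℝ → R4} {θ' : ℝ} {w' : R4} {t : ℝ}
    (hθ : HasDerivAt θ θ' t) (hw : HasDerivAt w w' t) :
    HasDerivAt (fun t => rot (θ t) (w t)) (rot (θ t) (w' - θ' • J (w t))) t := by
  have h := (hθ.cos.smul hw).sub (hθ.sin.smul (hasDerivAt_J hw))
  refine h.congr_deriv ?_
  simp only [rot, J_sub, J_smul, J_J]
  module

lemma xi_eq (a : ℝ) (z : R4) : xi a z = -(1 / a) • J z := by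
  simp only [xi, xi0]; module

lemma proj_eq (a : ℝ) (z : R4) : proj a z = Set.range fun t : ℝ => rot (t / a) z := by
  ext w
  constructor
  · rintro ⟨c, hc, h0, t, rfl⟩
    refine ⟨t, ?_⟩
    -- Uniqueness of the integral curve: turned back by the flow, it has zero derivative.
    have hd : ∀ s, HasDerivAt (fun s => rot (-(s / a)) (c s)) 0 s := fun s => by
      have h1 : HasDerivAt (fun s : ℝ => -(s / a)) (-(1 / a)) s := ((hasDerivAt_id s).div_const a).neg
      refine (hasDerivAt_rot h1 (hc s)).congr_deriv ?_
      rw [xi_eq, sub_self, rot_vzero]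
    have hconst := is_const_of_deriv_eq_zero (fun s => (hd s).differentiableAt)
      (fun s => (hd s).deriv) t 0
    simp only [h0, zero_div, neg_zero, rot_zero] at hconst
    rw [← hconst]
    exact rot_rot_neg _ _
  · rintro ⟨t, rfl⟩
    refine ⟨fun s => rot (s / a) z, fun s => ?_, by simp [rot_zero], t, rfl⟩
    refine (hasDerivAt_rot ((hasDerivAt_id s).div_const a) (hasDerivAt_const s z)).congr_deriv ?_
    rw [xi_eq, zero_sub, rot_neg, rot_smul, rot_J]
    simp

lemma mem_proj_self (a : ℝ) (z : R4) : z ∈ proj a z := by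
  rw [proj_eq a]; exact ⟨0, by simp [rot_zero]⟩

lemma proj_rot {a : ℝ} (ha : 0 < a) (θ : ℝ) (z : R4) : proj a (rot θ z) = proj a z := by
  simp only [proj_eq a, ← rot_add]
  refine Set.Subset.antisymm ?_ ?_
  · rintro _ ⟨t, rfl⟩
    -- Rotation by θ is the flow of ξ for time aθ.
    exact ⟨t + a * θ, by simp only; congr 1; field_simp⟩
  · rintro _ ⟨t, rfl⟩
    exact ⟨t - a * θ, by simp only; congr 1; field_simp; ring⟩

lemma exists_rot_of_proj_eq {a : ℝ} {z w : R4} (h : proj a w = proj a z) :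
    ∃ θ, w = rot θ z := by
  have := mem_proj_self a w
  rw [h, proj_eq a] at this
  obtain ⟨t, ht⟩ := this
  exact ⟨t / a, ht.symm⟩

/-! ### Horizontal frames -/

/-- With T and JT scaled by √a, the vectors z, Jz, T, JT form an orthonormal basis of ℝ⁴. -/
lemma eq_zero_of_frame {a : ℝ} (ha : 0 < a) {z T w : R4} (hz : z ∈ S3) (hT : ⟪T, z⟫_ℝ = 0)
    (hTJ : ⟪T, J z⟫_ℝ = 0) (hTT : a * ⟪T, T⟫_ℝ = 1) (h1 : ⟪z, w⟫_ℝ = 0) (h2 : ⟪J z, w⟫_ℝ = 0)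
    (h3 : ⟪T, w⟫_ℝ = 0) (h4 : ⟪J T, w⟫_ℝ = 0) : w = 0 := by
  have hzz := inner_self_of_mem hz
  have hzT : ⟪z, T⟫_ℝ = 0 := by rw [real_inner_comm]; exact hT
  have hzJT : ⟪z, J T⟫_ℝ = 0 := by rw [inner_J_comm, hTJ, neg_zero]
  have hs : √a * (√a * ⟪T, T⟫_ℝ) = 1 := by rw [← mul_assoc, Real.mul_self_sqrt ha.le, hTT]
  let v : Fin 4 → R4 := ![z, J z, √a • T, √a • J T]
  have hv : Orthonormal ℝ v := by
    rw [orthonormal_iff_ite]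
    intro i j
    fin_cases i <;> fin_cases j <;>
      simp only [v, Matrix.cons_val, Fin.mk_zero, Fin.mk_one, Fin.reduceFinMk,
        real_inner_smul_left, real_inner_smul_right, inner_J_left, J_J, inner_neg_right,
        inner_J_self, hzz, hT, hTJ, hzT, hzJT, neg_neg, hs] <;> simp
  have hsp : ⊤ ≤ Submodule.span ℝ (Set.range v) :=
    (hv.linearIndependent.span_eq_top_of_card_eq_finrank' (by simp)).ge
  have hb := (OrthonormalBasis.mk hv hsp).sum_repr' w
  rw [← hb]
  simp [Fin.sum_univ_four, v, real_inner_smul_left, h1, h2, h3, h4]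

/-- `γ` is a smooth horizontal curve in the sphere, of `g`-length `1`, on the open set `K`. -/
structure IsHorLift (a : ℝ) (K : Set ℝ) (γ : ℝ → R4) : Prop where
  isOpen : IsOpen K
  smooth : ContDiffOn ℝ ∞ γ K
  mem : ∀ t ∈ K, γ t ∈ S3
  horizontal : ∀ t ∈ K, ⟪deriv γ t, J (γ t)⟫_ℝ = 0
  unit : ∀ t ∈ K, a * ⟪deriv γ t, deriv γ t⟫_ℝ = 1

/-- The curvature of a horizontal curve. -/
def kap (a : ℝ) (γ : ℝ → R4) (t : ℝ) : ℝ := a * ⟪deriv (deriv γ) t, J (deriv γ t)⟫_ℝ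

lemma contDiffOn_deriv {E : Type*} [NormedAddCommGroup E] [NormedSpace ℝ E] {K : Set ℝ}
    (hK : IsOpen K) {f : ℝ → E} (hf : ContDiffOn ℝ ∞ f K) : ContDiffOn ℝ ∞ (deriv f) K :=
  ((contDiffOn_infty_iff_deriv_of_isOpen hK).1 hf).2

lemma hasDerivAt_of_contDiffOn {E : Type*} [NormedAddCommGroup E] [NormedSpace ℝ E] {K : Set ℝ}
    (hK : IsOpen K) {f : ℝ → E} (hf : ContDiffOn ℝ ∞ f K) {t : ℝ} (ht : t ∈ K) :
    HasDerivAt f (deriv f t) t :=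
  ((hf.contDiffAt (hK.mem_nhds ht)).differentiableAt (by simp)).hasDerivAt

namespace IsHorLift

variable {a : ℝ} {K : Set ℝ} {γ : ℝ → R4}

lemma mono (H : IsHorLift a K γ) {L : Set ℝ} (hL : IsOpen L) (hLK : L ⊆ K) : IsHorLift a L γ :=
  ⟨hL, H.smooth.mono hLK, fun t ht => H.mem t (hLK ht), fun t ht => H.horizontal t (hLK ht),
    fun t ht => H.unit t (hLK ht)⟩

lemma contDiffOn_deriv (H : IsHorLift a K γ) : ContDiffOn ℝ ∞ (deriv γ) K :=
  TannoSphere.contDiffOn_deriv H.isOpen H.smooth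

lemma hasDerivAt (H : IsHorLift a K γ) {t : ℝ} (ht : t ∈ K) : HasDerivAt γ (deriv γ t) t :=
  hasDerivAt_of_contDiffOn H.isOpen H.smooth ht

lemma hasDerivAt_deriv (H : IsHorLift a K γ) {t : ℝ} (ht : t ∈ K) :
    HasDerivAt (deriv γ) (deriv (deriv γ) t) t :=
  hasDerivAt_of_contDiffOn H.isOpen H.contDiffOn_deriv ht

lemma deriv_inner_eq_zero (hK : IsOpen K) {x y : ℝ → R4} {k : ℝ}
    (hxy : ∀ t ∈ K, ⟪x t, y t⟫_ℝ = k) {t : ℝ} (ht : t ∈ K) {x' y' : R4} (hx : HasDerivAt x x' t)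
    (hy : HasDerivAt y y' t) : ⟪x t, y'⟫_ℝ + ⟪x', y t⟫_ℝ = 0 := by
  have h1 : (fun t => ⟪x t, y t⟫_ℝ) =ᶠ[𝓝 t] fun _ => k := by
    filter_upwards [hK.mem_nhds ht] with s hs using hxy s hs
  rw [← (hx.inner ℝ hy).deriv, h1.deriv_eq, deriv_const]

lemma inner_deriv (H : IsHorLift a K γ) {t : ℝ} (ht : t ∈ K) : ⟪deriv γ t, γ t⟫_ℝ = 0 := by
  have h := deriv_inner_eq_zero H.isOpen (fun t ht => inner_self_of_mem (H.mem t ht)) ht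
    (H.hasDerivAt ht) (H.hasDerivAt ht)
  rw [real_inner_comm] at h
  linarith

/-- Differentiating ⟪γ', γ⟫ = 0, ⟪γ', Jγ⟫ = 0 and ⟪γ', γ'⟫ = 1/a fixes three components of γ'' in
the frame γ, Jγ, γ', Jγ'; the fourth is κ by definition. -/
lemma deriv_deriv (H : IsHorLift a K γ) (ha : 0 < a) {t : ℝ} (ht : t ∈ K) :
    deriv (deriv γ) t = -(1 / a) • γ t + kap a γ t • J (deriv γ t) := by
  have hzz := inner_self_of_mem (H.mem t ht)
  have h0 := H.inner_deriv ht
  have h0' : ⟪γ t, deriv γ t⟫_ℝ = 0 := by rw [real_inner_comm]; exact h0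
  have hJ := H.horizontal t ht
  have hJ' : ⟪γ t, J (deriv γ t)⟫_ℝ = 0 := by rw [inner_J_comm, hJ, neg_zero]
  have hu := H.unit t ht
  have hu' : ⟪deriv γ t, deriv γ t⟫_ℝ = 1 / a := by field_simp; linarith
  have e1 := deriv_inner_eq_zero H.isOpen (fun t ht => H.inner_deriv ht) ht
    (H.hasDerivAt_deriv ht) (H.hasDerivAt ht)
  have e2 := deriv_inner_eq_zero H.isOpen (fun t ht => H.horizontal t ht) ht
    (H.hasDerivAt_deriv ht) (hasDerivAt_J (H.hasDerivAt ht))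
  have e3 := deriv_inner_eq_zero (k := 1 / a) H.isOpen
    (fun t ht => by have := H.unit t ht; field_simp; linarith) ht
    (H.hasDerivAt_deriv ht) (H.hasDerivAt_deriv ht)
  rw [inner_J_self, zero_add] at e2
  rw [real_inner_comm] at e3
  have e3' : ⟪deriv (deriv γ) t, deriv γ t⟫_ℝ = 0 := by linarith
  have e1' : ⟪deriv (deriv γ) t, γ t⟫_ℝ = -(1 / a) := by linarith
  rw [← sub_eq_zero]
  apply eq_zero_of_frame ha (H.mem t ht) h0 hJ hu
  · rw [inner_sub_right, real_inner_comm, e1', inner_add_right, real_inner_smul_right,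
      real_inner_smul_right, hzz, hJ']
    ring
  · rw [inner_sub_right, real_inner_comm, e2, inner_add_right, real_inner_smul_right,
      real_inner_smul_right, inner_J_J, h0', inner_J_left, inner_J_self]
    ring
  · rw [inner_sub_right, real_inner_comm, e3', inner_add_right, real_inner_smul_right,
      real_inner_smul_right, h0, inner_J_self]
    ring
  · rw [inner_sub_right, real_inner_comm, inner_add_right, real_inner_smul_right,
      real_inner_smul_right, inner_J_J, hu', inner_J_left, hJ, kap]
    field_simp
    ring

lemma contDiffOn_J {K : Set ℝ} {w : ℝ → R4} (hw : ContDiffOn ℝ ∞ w K) :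
    ContDiffOn ℝ ∞ (fun t => J (w t)) K := Jcl.contDiff.comp_contDiffOn hw

lemma contDiffOn_kap (H : IsHorLift a K γ) : ContDiffOn ℝ ∞ (kap a γ) K :=
  contDiffOn_const.mul ((TannoSphere.contDiffOn_deriv H.isOpen H.contDiffOn_deriv).inner ℝ
    (contDiffOn_J H.contDiffOn_deriv))

end IsHorLift

/-! ### The Hopf tube over a horizontal curve -/

/-- The field `(u, v) ↦ e^{-Jv/a} w(u)`. -/
def tube (a : ℝ) (w : ℝ → R4) (p : R2) : R4 := rot (p 1 / a) (w (p 0))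

lemma hasFDerivAt_tube (a : ℝ) {w : ℝ → R4} {w' : R4} {q : R2} (hw : HasDerivAt w w' (q 0)) :
    ∃ L : R2 →L[ℝ] R4, HasFDerivAt (tube a w) L q ∧
      ∀ v, L v = rot (q 1 / a) (v 0 • w' - (v 1 / a) • J (w (q 0))) := by
  have hp : ∀ i : Fin 2, HasFDerivAt (fun p : R2 => p i)
      (ContinuousLinearMap.proj (R := ℝ) (φ := fun _ : Fin 2 => ℝ) i) q := fun i =>
    (ContinuousLinearMap.proj (R := ℝ) (φ := fun _ : Fin 2 => ℝ) i).hasFDerivAt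
  have h1 : HasFDerivAt (fun p : R2 => p 1 / a) _ q := (hp 1).mul_const a⁻¹
  have h0 : HasFDerivAt (fun p : R2 => w (p 0)) _ q := HasFDerivAt.comp q hw.hasFDerivAt (hp 0)
  have h : HasFDerivAt (fun p : R2 => Real.cos (p 1 / a) • w (p 0) -
      Real.sin (p 1 / a) • Jcl (w (p 0))) _ q :=
    (h1.cos.smul h0).sub (h1.sin.smul (Jcl.hasFDerivAt.comp q h0))
  refine ⟨_, h, fun v => ?_⟩
  simp [Jcl_apply, rot, J_sub, J_smul, J_J]
  match_scalars <;> field_simp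

lemma pd_zero_tube (a : ℝ) {w : ℝ → R4} {w' : R4} {q : R2} (hw : HasDerivAt w w' (q 0)) :
    pd 0 (tube a w) q = rot (q 1 / a) w' := by
  obtain ⟨L, hL, hv⟩ := hasFDerivAt_tube a hw
  rw [pd, hL.fderiv, hv]
  simp

lemma pd_one_tube (a : ℝ) {w : ℝ → R4} {w' : R4} {q : R2} (hw : HasDerivAt w w' (q 0)) :
    pd 1 (tube a w) q = rot (q 1 / a) (-(1 / a) • J (w (q 0))) := by
  obtain ⟨L, hL, hv⟩ := hasFDerivAt_tube a hw
  rw [pd, hL.fderiv, hv]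
  simp

lemma differentiableAt_tube (a : ℝ) {w : ℝ → R4} {w' : R4} {q : R2} (hw : HasDerivAt w w' (q 0)) :
    DifferentiableAt ℝ (tube a w) q := by
  obtain ⟨L, hL, _⟩ := hasFDerivAt_tube a hw
  exact hL.differentiableAt

lemma contDiffOn_tube (a : ℝ) {w : ℝ → R4} {K : Set ℝ} (hw : ContDiffOn ℝ ∞ w K) :
    ContDiffOn ℝ ∞ (tube a w) {q | q 0 ∈ K} := by
  have h1 : ContDiff ℝ ∞ (fun p : R2 => p 1 / a) := (contDiff_apply ℝ ℝ (1 : Fin 2)).div_const a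
  have h0 : ContDiffOn ℝ ∞ (fun p : R2 => w (p 0)) {q | q 0 ∈ K} :=
    hw.comp (contDiff_apply ℝ ℝ (0 : Fin 2)).contDiffOn fun q hq => hq
  exact (h1.cos.contDiffOn.smul h0).sub
    (h1.sin.contDiffOn.smul (Jcl.contDiff.comp_contDiffOn h0))

/-! ### Metric, connection, tension and bitension of the tube -/

namespace IsHorLift

variable {a : ℝ} {K : Set ℝ} {γ : ℝ → R4}

lemma isOpen_strip (H : IsHorLift a K γ) : IsOpen {q : R2 | q 0 ∈ K} :=
  H.isOpen.preimage (continuous_apply 0)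

/-- The coordinate fields are rotated copies of γ' and ξ, which are orthonormal for `g a` along γ.
-/
lemma tube_flat (H : IsHorLift a K γ) (ha : 0 < a) {q : R2} (hq : q 0 ∈ K) :
    indMetric (g a) (tube a γ) q = 1 := by
  have hzz := inner_self_of_mem (H.mem _ hq)
  have hu := H.unit _ hq
  have hJ := H.horizontal _ hq
  have h0 : pd 0 (tube a γ) q = _ := pd_zero_tube a (H.hasDerivAt hq)
  have h1 : pd 1 (tube a γ) q = _ := pd_one_tube a (H.hasDerivAt hq)
  have hJ' : ⟪J (γ (q 0)), deriv γ (q 0)⟫_ℝ = 0 := by rw [real_inner_comm]; exact hJ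
  ext i j
  fin_cases i <;> fin_cases j <;>
    simp only [Fin.mk_zero, Fin.mk_one, indMetric, Matrix.of_apply, h0, h1, tube, g,
      inner_rot_rot, eta0_rot, Matrix.one_apply] <;>
    simp only [eta0_eq, real_inner_smul_left, real_inner_smul_right, hJ, hJ', inner_J_J, hzz] <;>
    simp
  · rw [← real_inner_self_eq_norm_sq]; exact hu
  · field_simp; ring

lemma isFlatFactor (H : IsHorLift a K γ) (ha : 0 < a) {U : Set R2} {F : R2 → R4} {φ : R2 → R2}
    (hU : IsOpen U) (hφ : ContDiffOn ℝ ∞ φ U) (hm : ∀ p ∈ U, φ p 0 ∈ K)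
    (hF : ∀ p ∈ U, F p = rot (φ p 1 / a) (γ (φ p 0)))
    (hi : ∀ p ∈ U, Function.Injective (fderiv ℝ F p)) :
    IsFlatFactor a {q | q 0 ∈ K} (tube a γ) U F φ where
  isOpen_target := H.isOpen_strip
  smooth := contDiffOn_tube a H.smooth
  mem _ hq := rot_mem _ (H.mem _ hq)
  flat _ hq := H.tube_flat ha hq
  isOpen_source := hU
  smooth_coord := hφ
  mapsTo := hm
  eq := hF
  injective := hi

lemma cd_zero_tube (H : IsHorLift a K γ) (ha : 0 < a) {w : ℝ → R4} {w' : R4} {q : R2}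
    (hq : q 0 ∈ K) (hw : HasDerivAt w w' (q 0)) (ht : ⟪w (q 0), γ (q 0)⟫_ℝ = 0) :
    cd (g a) (tube a γ) 0 (tube a w) q = rot (q 1 / a) (w' - ⟪w', γ (q 0)⟫_ℝ • γ (q 0) -
      ((1 - a) * ⟪w (q 0), J (γ (q 0))⟫_ℝ) • J (deriv γ (q 0))) := by
  have h0 : pd 0 (tube a γ) q = _ := pd_zero_tube a (H.hasDerivAt hq)
  have h1 : pd 0 (tube a w) q = _ := pd_zero_tube a hw
  have h : cd (g a) (tube a γ) 0 (tube a w) q =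
      lc a (tube a γ q) (pd 0 (tube a γ) q) (tube a w q) (pd 0 (tube a w) q) := by
    refine leviCivita_eq ha (rot_mem _ (H.mem _ hq)) ?_ ?_ _
    · change ⟪pd 0 (tube a γ) q, _⟫_ℝ = 0
      rw [h0, inner_rot_rot, H.inner_deriv hq]
    · rw [tube, inner_rot_rot, ht]
  rw [h, h0, h1, tube, tube, lc_rot]
  congr 1
  simp only [lc, eta0_eq, H.horizontal _ hq]
  module

/-- The Euclidean derivative along ξ contributes -(1/a)Jw and the correction term ((1 - a)/a)Jw;
together they give -Jw, free of a. -/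
lemma cd_one_tube (H : IsHorLift a K γ) (ha : 0 < a) {w : ℝ → R4} {w' : R4} {q : R2}
    (hq : q 0 ∈ K) (hw : HasDerivAt w w' (q 0)) (ht : ⟪w (q 0), γ (q 0)⟫_ℝ = 0) :
    cd (g a) (tube a γ) 1 (tube a w) q = rot (q 1 / a)
      (-J (w (q 0)) - ⟪w (q 0), J (γ (q 0))⟫_ℝ • γ (q 0)) := by
  have h0 : pd 1 (tube a γ) q = _ := pd_one_tube a (H.hasDerivAt hq)
  have h1 : pd 1 (tube a w) q = _ := pd_one_tube a hw
  have hz := inner_self_of_mem (H.mem _ hq)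
  have h : cd (g a) (tube a γ) 1 (tube a w) q =
      lc a (tube a γ q) (pd 1 (tube a γ) q) (tube a w q) (pd 1 (tube a w) q) := by
    refine leviCivita_eq ha (rot_mem _ (H.mem _ hq)) ?_ ?_ _
    · change ⟪pd 1 (tube a γ) q, _⟫_ℝ = 0
      rw [h0, inner_rot_rot, real_inner_smul_left, inner_J_left, inner_J_self]
      simp
    · rw [tube, inner_rot_rot, ht]
  rw [h, h0, h1, tube, tube, lc_rot]
  congr 1
  simp only [lc, eta0_eq, real_inner_smul_left, inner_J_left, J_smul, J_J, inner_neg_right, hz]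
  match_scalars <;> field_simp <;> ring

variable {U : Set R2} {F : R2 → R4} {φ : R2 → R2}

/-- The u-direction contributes the tangential part κJγ' of γ''; the v-direction contributes nothing
because the fibres are geodesics. -/
lemma sum_cd_tube (H : IsHorLift a K γ) (ha : 0 < a) {q : R2} (hq : q 0 ∈ K) :
    ∑ m, cd (g a) (tube a γ) m (pd m (tube a γ)) q =
      tube a (fun t => kap a γ t • J (deriv γ t)) q := by
  have hz := inner_self_of_mem (H.mem _ hq)
  have e : ∀ m : Fin 2, ∀ {W : R2 → R4}, pd m (tube a γ) =ᶠ[𝓝 q] W →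
      cd (g a) (tube a γ) m (pd m (tube a γ)) q = cd (g a) (tube a γ) m W q := fun m W h => by
    simp only [cd, covD, h.eq_of_nhds, h.fderiv_eq]
  have e0 : pd 0 (tube a γ) =ᶠ[𝓝 q] tube a (deriv γ) := by
    filter_upwards [H.isOpen_strip.mem_nhds hq] with r hr using pd_zero_tube a (H.hasDerivAt hr)
  have e1 : pd 1 (tube a γ) =ᶠ[𝓝 q] tube a (fun t => -(1 / a) • J (γ t)) := by
    filter_upwards [H.isOpen_strip.mem_nhds hq] with r hr using pd_one_tube a (H.hasDerivAt hr)
  have h0 := H.inner_deriv hq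
  rw [Fin.sum_univ_two, e 0 e0, e 1 e1, H.cd_zero_tube ha hq (H.hasDerivAt_deriv hq) h0,
    H.cd_one_tube ha hq (w := fun t => -(1 / a) • J (γ t))
      ((hasDerivAt_J (H.hasDerivAt hq)).const_smul (-(1 / a)))
      (by rw [real_inner_smul_left, inner_J_left, inner_J_self]; simp),
    ← rot_vadd, tube]
  congr 1
  rw [H.deriv_deriv ha hq, H.horizontal _ hq]
  simp only [inner_add_left, real_inner_smul_left, inner_J_left, J_smul, J_J, hz,
    H.horizontal _ hq, inner_neg_right]
  module

lemma tension_tube (H : IsHorLift a K γ) (ha : 0 < a)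
    (hF : IsFlatFactor a {q | q 0 ∈ K} (tube a γ) U F φ) {p : R2} (hp : p ∈ U) :
    tension (g a) F p = rot (φ p 1 / a) (kap a γ (φ p 0) • J (deriv γ (φ p 0))) := by
  rw [hF.tension_eq ha hp, H.sum_cd_tube ha (hF.mapsTo p hp), tube]

/-- Write T = γ' and N = Jγ'. The covariant derivative of κN is κ'N - κ²T + κξ along T and κT along
ξ. Differentiating again, the normal part of the trace is κ'' - κ³ - 2κ, each direction supplying
one -κ, and the curvature trace adds (4/a - 2)κ. -/
lemma bitension_tube (H : IsHorLift a K γ) (ha : 0 < a)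
    (hF : IsFlatFactor a {q | q 0 ∈ K} (tube a γ) U F φ) {p : R2} (hp : p ∈ U) {t k k₁ k₂ : ℝ}
    (ht : φ p 0 = t) (hk : kap a γ t = k) (hk₁ : deriv (kap a γ) t = k₁)
    (hk₂ : deriv (deriv (kap a γ)) t = k₂) :
    bitension (g a) F p = rot (φ p 1 / a) ((k₂ - k ^ 3 - 2 * k + (4 / a - 2) * k) • J (deriv γ t)
      - (3 * k * k₁) • deriv γ t - (2 * k₁ / a) • J (γ t)) := by
  have hκ : ∀ t ∈ K, HasDerivAt (kap a γ) (deriv (kap a γ) t) t := fun t ht =>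
    hasDerivAt_of_contDiffOn H.isOpen H.contDiffOn_kap ht
  have hκ' : ∀ t ∈ K, HasDerivAt (deriv (kap a γ)) (deriv (deriv (kap a γ)) t) t := fun t ht =>
    hasDerivAt_of_contDiffOn H.isOpen
      (TannoSphere.contDiffOn_deriv H.isOpen H.contDiffOn_kap) ht
  have hT : ∀ t ∈ K, HasDerivAt (fun t => kap a γ t • J (deriv γ t)) _ t := fun t ht =>
    (hκ t ht).smul (hasDerivAt_J (H.hasDerivAt_deriv ht))
  have hD1 : ∀ t ∈ K, HasDerivAt (fun t => kap a γ t • deriv γ t) _ t := fun t ht =>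
    (hκ t ht).smul (H.hasDerivAt_deriv ht)
  have hD0 : ∀ t ∈ K, HasDerivAt (fun t => deriv (kap a γ) t • J (deriv γ t) -
      kap a γ t ^ 2 • deriv γ t - (kap a γ t / a) • J (γ t)) _ t := fun t ht =>
    (((hκ' t ht).smul (hasDerivAt_J (H.hasDerivAt_deriv ht))).sub
      (((hκ t ht).fun_pow 2).smul (H.hasDerivAt_deriv ht))).sub
      (((hκ t ht).div_const a).smul (hasDerivAt_J (H.hasDerivAt ht)))
  have hTt : ∀ t ∈ K, ⟪kap a γ t • J (deriv γ t), γ t⟫_ℝ = 0 := fun t ht => by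
    rw [real_inner_smul_left, inner_J_left, H.horizontal t ht]; simp
  have hD1t : ∀ t ∈ K, ⟪kap a γ t • deriv γ t, γ t⟫_ℝ = 0 := fun t ht => by
    rw [real_inner_smul_left, H.inner_deriv ht]; simp
  have hD0t : ∀ t ∈ K, ⟪deriv (kap a γ) t • J (deriv γ t) -
      kap a γ t ^ 2 • deriv γ t - (kap a γ t / a) • J (γ t), γ t⟫_ℝ = 0 := fun t ht => by
    simp only [inner_sub_left, real_inner_smul_left, inner_J_left, H.horizontal t ht,
      H.inner_deriv ht, inner_J_self]
    simp
  have hq := hF.mapsTo p hp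
  have hz := inner_self_of_mem (H.mem _ hq)
  have hh := H.horizontal _ hq
  have hi := H.inner_deriv hq
  have hu := H.unit _ hq
  have hdd := fun {t} => H.deriv_deriv ha (t := t)
  rw [hF.bitension_eq ha (T := tube a (fun t => kap a γ t • J (deriv γ t)))
    (D := ![tube a (fun t => deriv (kap a γ) t • J (deriv γ t) - kap a γ t ^ 2 • deriv γ t -
      (kap a γ t / a) • J (γ t)), tube a (fun t => kap a γ t • deriv γ t)])
    (fun q hq => H.sum_cd_tube ha hq) (fun q hq => differentiableAt_tube a (hT _ hq))
    (fun q hq => by rw [tube, tube, inner_rot_rot]; exact hTt _ hq)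
    (Fin.forall_fin_two.2 ⟨fun q hq => ?_, fun q hq => ?_⟩)
    (Fin.forall_fin_two.2 ⟨fun q hq => differentiableAt_tube a (hD0 _ hq),
      fun q hq => differentiableAt_tube a (hD1 _ hq)⟩)
    (Fin.forall_fin_two.2 ⟨fun q hq => ?_, fun q hq => ?_⟩) hp]
  · have hc := curv_trace ha (z := tube a γ (φ p)) (T := rot (φ p 1 / a) (deriv γ (φ p 0)))
      (rot_mem _ (H.mem _ hq)) (by rw [tube, inner_rot_rot, hi]) (by rw [tube, inner_rot_J_rot, hh])
      (by rw [inner_rot_rot, hu]) (kap a γ (φ p 0))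
    have hp0 : pd 0 (tube a γ) (φ p) = _ := pd_zero_tube a (H.hasDerivAt hq)
    have hp1 : pd 1 (tube a γ) (φ p) = _ := pd_one_tube a (H.hasDerivAt hq)
    rw [Fin.sum_univ_two, Fin.sum_univ_two, hp0, hp1]
    simp only [Matrix.cons_val]
    rw [H.cd_zero_tube ha hq (hD0 _ hq) (hD0t _ hq), H.cd_one_tube ha hq (hD1 _ hq) (hD1t _ hq)]
    have e1 : rot (φ p 1 / a) (-(1 / a) • J (γ (φ p 0))) = -(1 / a) • J (tube a γ (φ p)) := by
      rw [rot_smul, rot_J, tube]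
    have e2 : tube a (fun t => kap a γ t • J (deriv γ t)) (φ p) =
        kap a γ (φ p 0) • J (rot (φ p 1 / a) (deriv γ (φ p 0))) := by
      rw [tube, rot_smul, rot_J]
    rw [e1, e2, hc, ← rot_J, ← rot_smul, ← rot_neg, ← rot_vadd, ← rot_vsub]
    congr 1
    rw [hdd hq]
    subst hk hk₁ hk₂ ht
    simp only [inner_add_left, inner_sub_left, real_inner_smul_left, inner_J_left, inner_J_self,
      J_smul, J_J, J_add, hz, hh, hi, inner_neg_right, inner_neg_left]
    match_scalars <;> field_simp <;> ring
  · rw [H.cd_zero_tube ha hq (hT _ hq) (hTt _ hq)]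
    simp only [Matrix.cons_val, tube]
    congr 1
    rw [hdd hq]
    have hh := H.horizontal _ hq
    have hi := H.inner_deriv hq
    simp only [inner_add_left, real_inner_smul_left, inner_J_left, inner_J_self,
      J_smul, J_J, J_add, hh, hi, inner_neg_right, inner_neg_left]
    match_scalars <;> field_simp <;> ring
  · rw [H.cd_one_tube ha hq (hT _ hq) (hTt _ hq)]
    simp only [Matrix.cons_val, tube]
    congr 1
    simp only [real_inner_smul_left, inner_J_left, J_smul, J_J, inner_neg_right, H.inner_deriv hq]
    module
  · simp only [Matrix.cons_val, tube]
    rw [inner_rot_rot]; exact hD0t _ hq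
  · simp only [Matrix.cons_val, tube]
    rw [inner_rot_rot]; exact hD1t _ hq

end IsHorLift

/-! ### Existence of horizontal lifts -/

/-- A ball contains the segments from its centre, so integration from s is possible throughout; the
integral is smooth because its derivative is. -/
lemma exists_primitive {s δ : ℝ} (hδ : 0 < δ) {f : ℝ → ℝ}
    (hf : ContDiffOn ℝ ∞ f (Metric.ball s δ)) :
    ∃ α : ℝ → ℝ, ContDiffOn ℝ ∞ α (Metric.ball s δ) ∧
      ∀ t ∈ Metric.ball s δ, HasDerivAt α (f t) t := by
  have hd : ∀ t ∈ Metric.ball s δ, HasDerivAt (fun t => ∫ x in s..t, f x) (f t) t := by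
    intro t ht
    have hsub : Set.uIcc s t ⊆ Metric.ball s δ := by
      rw [← segment_eq_uIcc]
      exact (convex_ball s δ).segment_subset (Metric.mem_ball_self hδ) ht
    exact intervalIntegral.integral_hasDerivAt_right
      (hf.continuousOn.mono hsub).intervalIntegrable
      (hf.continuousOn.stronglyMeasurableAtFilter Metric.isOpen_ball t ht)
      (hf.continuousOn.continuousAt (Metric.isOpen_ball.mem_nhds ht))
  refine ⟨_, ?_, hd⟩
  rw [contDiffOn_infty_iff_deriv_of_isOpen Metric.isOpen_ball]
  exact ⟨fun t ht => (hd t ht).differentiableAt.differentiableWithinAt,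
    hf.congr fun t ht => (hd t ht).deriv⟩

lemma contDiffOn_rot {K : Set ℝ} {θ : ℝ → ℝ} {w : ℝ → R4} (hθ : ContDiffOn ℝ ∞ θ K)
    (hw : ContDiffOn ℝ ∞ w K) : ContDiffOn ℝ ∞ (fun t => rot (θ t) (w t)) K :=
  (hθ.cos.smul hw).sub (hθ.sin.smul (IsHorLift.contDiffOn_J hw))

lemma hor_eq {a : ℝ} (ha : 0 < a) (z X : R4) : hor a z X = X - ⟪X, J z⟫_ℝ • J z := by
  simp only [hor, eta, eta0_eq, xi_eq]
  match_scalars <;> field_simp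

/-- Rotating a lift β by a variable angle α turns its velocity into the rotation of β' - α'Jβ.
Choosing α' = ⟪β', Jβ⟫ leaves the rotated horizontal part. -/
lemma exists_horLift {a : ℝ} (ha : 0 < a) {I : Set ℝ} {c : ℝ → Set R4} (hI : IsOpen I)
    (hc : IsUnitSpeedCurve a I c) {s : ℝ} (hs : s ∈ I) :
    ∃ δ > 0, ∃ γ, Metric.ball s δ ⊆ I ∧ IsHorLift a (Metric.ball s δ) γ ∧
      ∀ t ∈ Metric.ball s δ, proj a (γ t) = c t := by
  obtain ⟨β, K, hK, hsK, hβ, hβK⟩ := hc s hs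
  obtain ⟨δ, hδ, hball⟩ := Metric.isOpen_iff.1 (hK.inter hI) s ⟨hsK, hs⟩
  have hβb : ContDiffOn ℝ ∞ β (Metric.ball s δ) := hβ.mono fun t ht => (hball ht).1
  have hβd : ∀ t ∈ Metric.ball s δ, HasDerivAt β (deriv β t) t := fun t ht =>
    hasDerivAt_of_contDiffOn Metric.isOpen_ball hβb ht
  obtain ⟨α, hα, hαd⟩ := exists_primitive hδ
    ((contDiffOn_deriv Metric.isOpen_ball hβb).inner ℝ (IsHorLift.contDiffOn_J hβb))
  have hd : ∀ t ∈ Metric.ball s δ, deriv (fun t => rot (α t) (β t)) t =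
      rot (α t) (hor a (β t) (deriv β t)) := fun t ht => by
    rw [(hasDerivAt_rot (hαd t ht) (hβd t ht)).deriv, hor_eq ha]
  refine ⟨δ, hδ, fun t => rot (α t) (β t), fun t ht => (hball ht).2,
    ⟨Metric.isOpen_ball, contDiffOn_rot hα hβb, fun t ht => rot_mem _ (hβK t (hball ht).1).1,
      fun t ht => ?_, fun t ht => ?_⟩, fun t ht => ?_⟩
  · have hz := inner_self_of_mem (hβK t (hball ht).1).1
    rw [hd t ht, inner_rot_J_rot, hor_eq ha, inner_sub_left, real_inner_smul_left, inner_J_J, hz]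
    ring
  · obtain ⟨hz, -, hg⟩ := hβK t (hball ht).1
    have hz := inner_self_of_mem hz
    have h0 : eta0 (β t) (hor a (β t) (deriv β t)) = 0 := by
      rw [eta0_eq, hor_eq ha, inner_sub_left, real_inner_smul_left, inner_J_J, hz]
      ring
    rw [hd t ht, inner_rot_rot]
    simpa [g, h0] using hg
  · rw [proj_rot ha, (hβK t (hball ht).1).2.1]

/-! ### Local parametrizations of a Hopf cylinder -/

lemma IsHorLift.isLocalParam {a : ℝ} (ha : 0 < a) {I K : Set ℝ} {c : ℝ → Set R4} {γ : ℝ → R4}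
    (H : IsHorLift a K γ) (hKI : K ⊆ I) (hc : ∀ t ∈ K, proj a (γ t) = c t) :
    IsLocalParam a I c {q | q 0 ∈ K} (tube a γ) := by
  refine ⟨H.isOpen_strip, contDiffOn_tube a H.smooth, fun q hq => ?_, fun q => q 0,
    (contDiff_apply ℝ ℝ (0 : Fin 2)).contDiffOn, fun q hq =>
      ⟨hKI hq, rot_mem _ (H.mem _ hq), by rw [tube, proj_rot ha, hc _ hq]⟩⟩
  obtain ⟨L, hL, hv⟩ := hasFDerivAt_tube a (H.hasDerivAt hq)
  rw [hL.fderiv, injective_iff_map_eq_zero]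
  intro v h
  have hz := inner_self_of_mem (H.mem _ hq)
  have hu := H.unit _ hq
  have hJ := H.horizontal _ hq
  have hJ' : ⟪J (γ (q 0)), deriv γ (q 0)⟫_ℝ = 0 := by rw [real_inner_comm]; exact hJ
  rw [hv, ← rot_vzero (q 1 / a)] at h
  have h := rot_injective _ h
  -- γ' and Jγ are orthogonal and non-zero, so pairing with them isolates the two components of v.
  have e0 := congrArg (fun w => ⟪w, deriv γ (q 0)⟫_ℝ) h
  have e1 := congrArg (fun w => ⟪w, J (γ (q 0))⟫_ℝ) h
  simp only [inner_sub_left, real_inner_smul_left, inner_zero_left, hJ, hJ', inner_J_J, hz] at e0 e1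
  have hne : ⟪deriv γ (q 0), deriv γ (q 0)⟫_ℝ ≠ 0 := by
    intro h0; rw [h0] at hu; norm_num at hu
  have v0 : v 0 = 0 := (mul_eq_zero.1 (by linear_combination e0)).resolve_right hne
  have v1 : v 1 = 0 := by simpa [ha.ne'] using e1
  ext i
  exact (Fin.forall_fin_two.2 ⟨v0, v1⟩ : ∀ i, v i = 0) i

/-- Every local parametrization is, locally, a reparametrization of the tube over a lift. -/
lemma IsLocalParam.exists_flatFactor {a : ℝ} (ha : 0 < a) {I K : Set ℝ} {c : ℝ → Set R4}
    {γ : ℝ → R4} (H : IsHorLift a K γ) (hc : ∀ t ∈ K, proj a (γ t) = c t) {U : Set R2}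
    {F : R2 → R4} (hU : IsOpen U) (hF : ContDiffOn ℝ ∞ F U)
    (hi : ∀ p ∈ U, Function.Injective (fderiv ℝ F p)) {σ : R2 → ℝ} (hσ : ContDiffOn ℝ ∞ σ U)
    (hm : ∀ p ∈ U, σ p ∈ I ∧ F p ∈ S3 ∧ proj a (F p) = c (σ p)) {p : R2} (hp : p ∈ U)
    (hpK : σ p ∈ K) : ∃ U' φ, p ∈ U' ∧ φ p 0 = σ p ∧
      IsFlatFactor a {q | q 0 ∈ K} (tube a γ) U' F φ := by
  have hex : ∀ q ∈ U, σ q ∈ K → ∃ θ, F q = rot θ (γ (σ q)) := fun q hq hqK =>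
    exists_rot_of_proj_eq ((hm q hq).2.2.trans (hc _ hqK).symm)
  obtain ⟨θ₀, hθ₀⟩ := hex p hp hpK
  have hU₁ : IsOpen (U ∩ σ ⁻¹' K) := hσ.continuousOn.isOpen_inter_preimage hU H.isOpen
  have hG : ContDiffOn ℝ ∞ (fun q => rot θ₀ (γ (σ q))) (U ∩ σ ⁻¹' K) := by
    have h : ContDiffOn ℝ ∞ (fun q => γ (σ q)) (U ∩ σ ⁻¹' K) :=
      H.smooth.comp (hσ.mono Set.inter_subset_left) fun q hq => hq.2
    exact ((contDiffOn_const (c := Real.cos θ₀)).smul h).sub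
      ((contDiffOn_const (c := Real.sin θ₀)).smul (Jcl.contDiff.comp_contDiffOn h))
  have hF₁ := hF.mono (Set.inter_subset_left (s := U) (t := σ ⁻¹' K))
  -- r and s are the cosine and sine of the fibre angle of F relative to the lift rotated by θ₀.
  -- They are smooth, although the angle itself is only given pointwise.
  let r : R2 → ℝ := fun q => ⟪F q, rot θ₀ (γ (σ q))⟫_ℝ
  let s : R2 → ℝ := fun q => -⟪F q, J (rot θ₀ (γ (σ q)))⟫_ℝ
  have hr : ContDiffOn ℝ ∞ r (U ∩ σ ⁻¹' K) := hF₁.inner ℝ hG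
  have hs : ContDiffOn ℝ ∞ s (U ∩ σ ⁻¹' K) :=
    (hF₁.inner ℝ (Jcl.contDiff.comp_contDiffOn hG)).neg
  have hrs : ∀ q ∈ U ∩ σ ⁻¹' K, r q ^ 2 + s q ^ 2 = 1 ∧
      F q = r q • rot θ₀ (γ (σ q)) - s q • J (rot θ₀ (γ (σ q))) := by
    rintro q ⟨hq, hqK⟩
    obtain ⟨θ, hθ⟩ := hex q hq hqK
    have hz := inner_self_of_mem (rot_mem θ₀ (H.mem _ hqK))
    have hθ' : F q = rot (θ - θ₀) (rot θ₀ (γ (σ q))) := by rw [hθ, ← rot_add, sub_add_cancel]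
    have e1 : r q = Real.cos (θ - θ₀) := by
      simp only [r, hθ']
      rw [rot, inner_sub_left, real_inner_smul_left, real_inner_smul_left, hz, inner_J_left,
        inner_J_self]
      ring
    have e2 : s q = Real.sin (θ - θ₀) := by
      simp only [s, hθ']
      rw [rot, inner_sub_left, real_inner_smul_left, real_inner_smul_left, inner_J_J, hz,
        inner_J_self]
      ring
    rw [e1, e2]
    exact ⟨Real.cos_sq_add_sin_sq _, hθ'⟩
  have hU' : IsOpen ((U ∩ σ ⁻¹' K) ∩ r ⁻¹' Set.Ioi 0) :=
    hr.continuousOn.isOpen_inter_preimage hU₁ isOpen_Ioi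
  have hs1 : ∀ q ∈ (U ∩ σ ⁻¹' K) ∩ r ⁻¹' Set.Ioi 0, -1 < s q ∧ s q < 1 := fun q hq => by
    have h1 := (hrs q hq.1).1
    have h2 : 0 < r q := hq.2
    constructor <;> nlinarith
  -- Where the cosine is positive the angle can be taken to be the arcsine of s, which is smooth
  -- there. The factor a compensates the division by a in `tube`.
  refine ⟨(U ∩ σ ⁻¹' K) ∩ r ⁻¹' Set.Ioi 0, fun q => ![σ q, a * (Real.arcsin (s q) + θ₀)],
    ⟨⟨hp, hpK⟩, ?_⟩, rfl, H.isFlatFactor ha hU' ?_ (fun q hq => hq.1.2) (fun q hq => ?_) (fun q hq => hi q hq.1.1)⟩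
  · have : r p = 1 := by
      simp only [r, hθ₀]
      exact inner_self_of_mem (rot_mem θ₀ (H.mem _ hpK))
    simp [this]
  · rw [contDiffOn_pi]
    refine Fin.forall_fin_two.2 ⟨hσ.mono fun q hq => hq.1.1, ?_⟩
    refine contDiffOn_const.mul (ContDiffOn.add (fun q hq => ?_) contDiffOn_const)
    exact (Real.contDiffAt_arcsin (hs1 q hq).1.ne' (hs1 q hq).2.ne).comp_contDiffWithinAt q
      ((hs q hq.1).mono Set.inter_subset_left)
  · have h1 := hrs q hq.1
    have h2 : 0 < r q := hq.2
    have h3 := hs1 q hq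
    have hcos : Real.cos (Real.arcsin (s q)) = r q := by
      rw [Real.cos_arcsin, ← h1.1, add_sub_cancel_right, Real.sqrt_sq h2.le]
    have hdiv : a * (Real.arcsin (s q) + θ₀) / a = Real.arcsin (s q) + θ₀ := by field_simp
    simp only [Matrix.cons_val, hdiv]
    rw [rot_add, rot, hcos, Real.sin_arcsin h3.1.le h3.2.le]
    exact h1.2

/-! ### Biharmonicity in terms of the curvature of the lift -/

/-- The tube itself is the test parametrization. The vertical component of its bitension is a
multiple of κ', so κ' = 0; the normal component then reads κ(4(1 - a)/a - κ²). -/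
lemma kap_of_isBiharmonic {a : ℝ} (ha : 0 < a) {I K : Set ℝ} {c : ℝ → Set R4} {γ : ℝ → R4}
    (hb : IsBiharmonic a I c) (H : IsHorLift a K γ) (hKI : K ⊆ I)
    (hc : ∀ t ∈ K, proj a (γ t) = c t) :
    (∀ t ∈ K, deriv (kap a γ) t = 0) ∧
      ∀ t ∈ K, kap a γ t = 0 ∨ kap a γ t ^ 2 = 4 * (1 - a) / a := by
  have hP := H.isLocalParam ha hKI hc
  have hF : IsFlatFactor a {q | q 0 ∈ K} (tube a γ) {q | q 0 ∈ K} (tube a γ) id :=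
    H.isFlatFactor ha H.isOpen_strip contDiffOn_id (fun _ hp => hp) (fun _ _ => rfl) hP.2.2.1
  have key : ∀ t ∈ K, (deriv (deriv (kap a γ)) t - kap a γ t ^ 3 - 2 * kap a γ t
      + (4 / a - 2) * kap a γ t) • J (deriv γ t) - (3 * kap a γ t * deriv (kap a γ) t) • deriv γ t
      - (2 * deriv (kap a γ) t / a) • J (γ t) = 0 := fun t ht => by
    have h := hb _ _ hP ![t, 0] ht
    rw [H.bitension_tube ha hF ht rfl rfl rfl rfl] at h
    simpa [rot_zero] using h
  have h1 : ∀ t ∈ K, deriv (kap a γ) t = 0 := fun t ht => by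
    have hz := inner_self_of_mem (H.mem _ ht)
    have e := congrArg (fun w => ⟪w, J (γ t)⟫_ℝ) (key t ht)
    simp only [inner_sub_left, real_inner_smul_left, inner_J_J, hz, H.inner_deriv ht,
      H.horizontal t ht, inner_zero_left] at e
    field_simp at e
    linarith
  refine ⟨h1, fun t ht => ?_⟩
  have h2 : deriv (deriv (kap a γ)) t = 0 := by
    have : deriv (kap a γ) =ᶠ[𝓝 t] fun _ => 0 := by
      filter_upwards [H.isOpen.mem_nhds ht] with s hs using h1 s hs
    rw [this.deriv_eq, deriv_const]
  have hu := H.unit t ht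
  have e := congrArg (fun w => ⟪w, J (deriv γ t)⟫_ℝ) (key t ht)
  simp only [h1 t ht, h2, inner_sub_left, real_inner_smul_left, inner_J_J, inner_zero_left] at e
  have e' : kap a γ t * (kap a γ t ^ 2 - 4 * (1 - a) / a) = 0 := by
    have hne : ⟪deriv γ t, deriv γ t⟫_ℝ ≠ 0 := by
      intro h0; rw [h0] at hu; norm_num at hu
    have e2 : 0 - kap a γ t ^ 3 - 2 * kap a γ t + (4 / a - 2) * kap a γ t = 0 :=
      (mul_eq_zero.1 (by linear_combination e)).resolve_right hne
    field_simp at e2 ⊢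
    linear_combination -e2
  rcases mul_eq_zero.1 e' with h | h
  · exact Or.inl h
  · exact Or.inr (by linarith)

/-- For this constant curvature every coefficient in `IsHorLift.bitension_tube` vanishes, whatever
the parametrization. As a < 1 forces k ≠ 0, the tension of the tube is non-zero. -/
lemma isProperBiharmonic_of_horLift {a : ℝ} (ha : 0 < a) (ha1 : a < 1) {I : Set ℝ}
    {c : ℝ → Set R4} {γ : ℝ → R4} (hI : I.Nonempty) (H : IsHorLift a I γ)
    (hc : ∀ t ∈ I, proj a (γ t) = c t) {k : ℝ} (hk : ∀ t ∈ I, kap a γ t = k)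
    (hk2 : k ^ 2 = 4 * (1 - a) / a) : IsProperBiharmonic a I c := by
  have hk1 : ∀ t ∈ I, deriv (kap a γ) t = 0 := fun t ht => by
    have : kap a γ =ᶠ[𝓝 t] fun _ => k := by
      filter_upwards [H.isOpen.mem_nhds ht] with s hs using hk s hs
    rw [this.deriv_eq, deriv_const]
  have hk2' : ∀ t ∈ I, deriv (deriv (kap a γ)) t = 0 := fun t ht => by
    have : deriv (kap a γ) =ᶠ[𝓝 t] fun _ => 0 := by
      filter_upwards [H.isOpen.mem_nhds ht] with s hs using hk1 s hs
    rw [this.deriv_eq, deriv_const]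
  constructor
  · rintro U F ⟨hU, hF, hi, σ, hσ, hm⟩ p hp
    obtain ⟨U', φ, hp', hφ, hflat⟩ :=
      IsLocalParam.exists_flatFactor ha H hc hU hF hi hσ hm hp (hm p hp).1
    have hpI := (hm p hp).1
    rw [H.bitension_tube ha hflat hp' hφ (hk _ hpI) (hk1 _ hpI) (hk2' _ hpI)]
    have : 0 - k ^ 3 - 2 * k + (4 / a - 2) * k = 0 := by
      have : k ^ 3 = k * (4 * (1 - a) / a) := by rw [← hk2]; ring
      rw [this]; field_simp; ring
    rw [this]
    simp [rot_vzero]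
  · intro hh
    obtain ⟨t, ht⟩ := hI
    have hP := H.isLocalParam ha le_rfl hc
    have hF : IsFlatFactor a {q | q 0 ∈ I} (tube a γ) {q | q 0 ∈ I} (tube a γ) id :=
      H.isFlatFactor ha H.isOpen_strip contDiffOn_id (fun _ hp => hp) (fun _ _ => rfl) hP.2.2.1
    have h := hh _ _ hP ![t, 0] ht
    rw [H.tension_tube ha hF ht] at h
    simp [rot_zero] at h
    have hu := H.unit t ht
    rcases h with h | h
    · rw [hk t ht] at h
      rw [h] at hk2
      have : 0 < 4 * (1 - a) / a := by
        apply div_pos _ ha; linarith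
      linarith
    · rw [← inner_J_J, h] at hu
      simp at hu

/-! ### Parametrization of a Hopf cylinder by a horizontal lift -/

lemma isParametrization_of_horLift {a : ℝ} (ha : 0 < a) {I : Set ℝ} {c : ℝ → Set R4} {γ : ℝ → R4}
    (H : IsHorLift a I γ) (hc : ∀ t ∈ I, proj a (γ t) = c t) :
    IsParametrization a I c (fun u v => rot (v / a) (γ u)) := by
  refine ⟨H.isLocalParam ha le_rfl hc, ?_, fun u hu => ⟨?_, fun v => ?_⟩⟩
  · ext z
    constructor
    · rintro ⟨⟨u, v⟩, ⟨hu, -⟩, rfl⟩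
      exact ⟨rot_mem _ (H.mem u hu), u, hu, by rw [proj_rot ha, hc u hu]⟩
    · rintro ⟨-, s, hs, h⟩
      have hz := mem_proj_self a z
      rw [h, ← hc s hs, proj_eq] at hz
      obtain ⟨t, ht⟩ := hz
      exact ⟨(s, t), ⟨hs, trivial⟩, ht⟩
  · rw [← hc u hu, proj_eq]
  · have hv : HasDerivAt (fun t => rot (t / a) (γ u)) _ v :=
      hasDerivAt_rot ((hasDerivAt_id v).div_const a) (hasDerivAt_const v (γ u))
    have hu' : HasDerivAt (fun s => rot (v / a) (γ s)) _ u :=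
      hasDerivAt_rot (hasDerivAt_const u (v / a)) (H.hasDerivAt hu)
    rw [hv.deriv, hu'.deriv]
    have h0 : eta0 (rot (v / a) (γ u)) (rot (v / a) (deriv γ u)) = 0 := by
      rw [eta0_rot, eta0_eq, H.horizontal u hu, neg_zero]
    simp only [zero_smul, sub_zero]
    refine ⟨?_, ?_, ?_⟩
    · rw [xi_eq, ← rot_J, ← rot_smul]
      simp
    · rw [eta, h0, mul_zero]
    · rw [g, h0, inner_rot_rot, H.unit u hu]; ring

/-! ### The explicit curve -/

/-- The radicand is positive because (3 - 2a)² - 4(a - 1)(a - 2) = 1. -/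
lemma cA_pos {a : ℝ} (ha0 : 0 < a) (ha1 : a < 1) : 0 < cA a := by
  have h : √((a - 1) * (a - 2)) < (3 - 2 * a) / 2 := by
    rw [Real.sqrt_lt' (by linarith)]
    nlinarith
  exact Real.sqrt_pos.2 (div_pos (by linarith) ha0)

lemma cB_pos {a : ℝ} (ha0 : 0 < a) (ha1 : a < 1) : 0 < cB a :=
  Real.sqrt_pos.2 (div_pos (by linarith [Real.sqrt_nonneg ((a - 1) * (a - 2))]) ha0)

lemma cA_sq {a : ℝ} (ha0 : 0 < a) (ha1 : a < 1) :
    cA a ^ 2 = (3 - 2 * a - 2 * √((a - 1) * (a - 2))) / a :=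
  Real.sq_sqrt (Real.sqrt_pos.1 (cA_pos ha0 ha1)).le

lemma cB_sq {a : ℝ} (ha0 : 0 < a) (ha1 : a < 1) :
    cB a ^ 2 = (3 - 2 * a + 2 * √((a - 1) * (a - 2))) / a :=
  Real.sq_sqrt (Real.sqrt_pos.1 (cB_pos ha0 ha1)).le

/-- A² and B² are conjugate, and the identity (3 - 2a)² - 4(a - 1)(a - 2) = 1 makes their product
1/a². -/
lemma cA_mul_cB {a : ℝ} (ha0 : 0 < a) (ha1 : a < 1) : cA a * cB a = 1 / a := by
  have hs : √((a - 1) * (a - 2)) ^ 2 = (a - 1) * (a - 2) := Real.sq_sqrt (by nlinarith)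
  have hA := cA_pos ha0 ha1
  have hB := cB_pos ha0 ha1
  have h : (cA a * cB a) ^ 2 = (1 / a) ^ 2 := by
    rw [mul_pow, cA_sq ha0 ha1, cB_sq ha0 ha1]
    field_simp
    linear_combination -4 * hs
  exact (sq_eq_sq₀ (by positivity) (by positivity)).1 h

/-- This is the critical value of κ², so a proper-biharmonic cylinder has κ = ±(B - A) wherever κ ≠
0. -/
lemma cB_sub_cA_sq {a : ℝ} (ha0 : 0 < a) (ha1 : a < 1) :
    (cB a - cA a) ^ 2 = 4 * (1 - a) / a := by
  have h : (cB a - cA a) ^ 2 = cB a ^ 2 + cA a ^ 2 - 2 * (cA a * cB a) := by ring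
  rw [h, cA_sq ha0 ha1, cB_sq ha0 ha1, cA_mul_cB ha0 ha1]
  field_simp
  ring

/-- The coefficient of `e₁` in the explicit surface. -/
def coef₁ (a : ℝ) : ℝ := √(cB a / (cA a + cB a))

/-- The coefficient of `e₃` in the explicit surface. -/
def coef₃ (a : ℝ) : ℝ := √(cA a / (cA a + cB a))

lemma coef₁_pos {a : ℝ} (ha0 : 0 < a) (ha1 : a < 1) : 0 < coef₁ a :=
  Real.sqrt_pos.2 (div_pos (cB_pos ha0 ha1) (add_pos (cA_pos ha0 ha1) (cB_pos ha0 ha1)))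

lemma coef₃_pos {a : ℝ} (ha0 : 0 < a) (ha1 : a < 1) : 0 < coef₃ a :=
  Real.sqrt_pos.2 (div_pos (cA_pos ha0 ha1) (add_pos (cA_pos ha0 ha1) (cB_pos ha0 ha1)))

lemma coef₁_sq {a : ℝ} (ha0 : 0 < a) (ha1 : a < 1) :
    coef₁ a ^ 2 * (cA a + cB a) = cB a := by
  have h := add_pos (cA_pos ha0 ha1) (cB_pos ha0 ha1)
  rw [coef₁, Real.sq_sqrt (div_pos (cB_pos ha0 ha1) h).le]
  field_simp

lemma coef₃_sq {a : ℝ} (ha0 : 0 < a) (ha1 : a < 1) :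
    coef₃ a ^ 2 * (cA a + cB a) = cA a := by
  have h := add_pos (cA_pos ha0 ha1) (cB_pos ha0 ha1)
  rw [coef₃, Real.sq_sqrt (div_pos (cA_pos ha0 ha1) h).le]
  field_simp

/-- The horizontal curve generating the explicit surface. -/
def genCurve (a ε : ℝ) (e₁ e₃ : R4) (u : ℝ) : R4 :=
  coef₁ a • rot (cA a * (ε * u)) e₁ + coef₃ a • rot (-(cB a * (ε * u))) e₃

/-- The angle of e₃ enters with the opposite sign, so both summands turn by the same v/a along the
fibre. -/
lemma surf_eq (a ε : ℝ) (e₁ e₃ : R4) (u v : ℝ) :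
    surf a e₁ e₃ (ε * u) v = rot (v / a) (genCurve a ε e₁ e₃ u) := by
  have h1 : cA a * (ε * u) + 1 / a * v = v / a + cA a * (ε * u) := by ring
  have h2 : cB a * (ε * u) - 1 / a * v = -(v / a + -(cB a * (ε * u))) := by ring
  rw [genCurve, rot_vadd, rot_smul, rot_smul, ← rot_add, ← rot_add, surf, h1, h2, Real.cos_neg,
    Real.sin_neg]
  simp only [rot, coef₁, coef₃]
  module

lemma inner_rot_eq_zero {x y : R4} (h : ⟪x, y⟫_ℝ = 0) (hJ : ⟪x, J y⟫_ℝ = 0) (s t : ℝ) :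
    ⟪rot s x, rot t y⟫_ℝ = 0 ∧ ⟪rot s x, J (rot t y)⟫_ℝ = 0 := by
  constructor <;>
    simp only [rot, J_sub, J_smul, J_J, inner_sub_left, inner_sub_right, real_inner_smul_left,
      real_inner_smul_right, inner_neg_right, inner_J_left, h, hJ] <;>
    ring

lemma IsAdmissible.inner_rot {e₁ e₃ : R4} (h : IsAdmissible e₁ e₃) (s t : ℝ) :
    ⟪rot s e₁, rot t e₃⟫_ℝ = 0 ∧ ⟪rot s e₁, J (rot t e₃)⟫_ℝ = 0 :=
  inner_rot_eq_zero h.2.2.1 (by rw [inner_J_comm, h.2.2.2, neg_zero]) s t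

lemma hasDerivAt_genCurve (a ε : ℝ) (e₁ e₃ : R4) (u : ℝ) :
    HasDerivAt (genCurve a ε e₁ e₃) (-(ε * cA a * coef₁ a) • J (rot (cA a * (ε * u)) e₁) +
      (ε * cB a * coef₃ a) • J (rot (-(cB a * (ε * u))) e₃)) u := by
  have hA : HasDerivAt (fun u => cA a * (ε * u)) (cA a * (ε * 1)) u :=
    ((hasDerivAt_id u).const_mul ε).const_mul (cA a)
  have hB : HasDerivAt (fun u => -(cB a * (ε * u))) (-(cB a * (ε * 1))) u :=
    (((hasDerivAt_id u).const_mul ε).const_mul (cB a)).neg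
  refine (((hasDerivAt_rot hA (hasDerivAt_const u e₁)).const_smul (coef₁ a)).add
    ((hasDerivAt_rot hB (hasDerivAt_const u e₃)).const_smul (coef₃ a))).congr_deriv ?_
  simp only [rot_vsub, rot_smul, rot_J, rot_vzero]
  module

lemma hasDerivAt_deriv_genCurve (a ε : ℝ) (e₁ e₃ : R4) (u : ℝ) :
    HasDerivAt (deriv (genCurve a ε e₁ e₃))
      (-(ε ^ 2 * cA a ^ 2 * coef₁ a) • rot (cA a * (ε * u)) e₁ -
        (ε ^ 2 * cB a ^ 2 * coef₃ a) • rot (-(cB a * (ε * u))) e₃) u := by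
  have h : deriv (genCurve a ε e₁ e₃) = fun u =>
      -(ε * cA a * coef₁ a) • J (rot (cA a * (ε * u)) e₁) +
        (ε * cB a * coef₃ a) • J (rot (-(cB a * (ε * u))) e₃) :=
    funext fun u => (hasDerivAt_genCurve a ε e₁ e₃ u).deriv
  have hA : HasDerivAt (fun u => cA a * (ε * u)) (cA a * (ε * 1)) u :=
    ((hasDerivAt_id u).const_mul ε).const_mul (cA a)
  have hB : HasDerivAt (fun u => -(cB a * (ε * u))) (-(cB a * (ε * 1))) u :=
    (((hasDerivAt_id u).const_mul ε).const_mul (cB a)).neg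
  rw [h]
  refine (((hasDerivAt_J (hasDerivAt_rot hA (hasDerivAt_const u e₁))).const_smul
      (-(ε * cA a * coef₁ a))).add
    ((hasDerivAt_J (hasDerivAt_rot hB (hasDerivAt_const u e₃))).const_smul
      (ε * cB a * coef₃ a))).congr_deriv ?_
  simp only [rot_vsub, rot_smul, rot_J, rot_vzero, J_sub, J_smul, J_zero, J_J]
  module

/-- The J-invariant planes of e₁ and e₃ are orthogonal, so each inner product is a sum of two terms
with weights B/(A + B) and A/(A + B). The weights add to 1, horizontality is -AB + BA = 0, and the
squared speed is a(A²B + B²A)/(A + B) = aAB = 1. -/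
lemma isHorLift_genCurve {a ε : ℝ} (ha0 : 0 < a) (ha1 : a < 1) (hε : ε ^ 2 = 1) {e₁ e₃ : R4}
    (h : IsAdmissible e₁ e₃) : IsHorLift a Set.univ (genCurve a ε e₁ e₃) := by
  have hn : ∀ (s : ℝ) {e : R4}, ‖e‖ = 1 → ⟪rot s e, rot s e⟫_ℝ = 1 := fun s e he => by
    rw [inner_rot_rot, real_inner_self_eq_norm_sq, he]; norm_num
  have hAB := cA_mul_cB ha0 ha1
  have hS := add_pos (cA_pos ha0 ha1) (cB_pos ha0 ha1)
  have h1 := coef₁_sq ha0 ha1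
  have h3 := coef₃_sq ha0 ha1
  have hrel : ∀ u, ⟪rot (cA a * (ε * u)) e₁, rot (-(cB a * (ε * u))) e₃⟫_ℝ = 0 ∧
      ⟪rot (-(cB a * (ε * u))) e₃, rot (cA a * (ε * u)) e₁⟫_ℝ = 0 := fun u => by
    have i1 := (h.inner_rot (cA a * (ε * u)) (-(cB a * (ε * u)))).1
    exact ⟨i1, by rw [real_inner_comm]; exact i1⟩
  refine ⟨isOpen_univ, ?_, fun u _ => ?_, fun u _ => ?_, fun u _ => ?_⟩
  · have hrot : ∀ (k : ℝ) (e : R4), ContDiffOn ℝ ∞ (fun u : ℝ => rot (k * (ε * u)) e) Set.univ :=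
      fun k e => contDiffOn_rot (contDiff_const.mul (contDiff_const.mul contDiff_id)).contDiffOn
        contDiffOn_const
    have := ((hrot (cA a) e₁).const_smul (coef₁ a)).add ((hrot (-cB a) e₃).const_smul (coef₃ a))
    refine this.congr fun u _ => ?_
    simp [genCurve]
  · obtain ⟨i1, i2⟩ := hrel u
    apply mem_of_inner_self
    simp only [genCurve, inner_add_left, inner_add_right, real_inner_smul_left,
      real_inner_smul_right, hn _ h.1, hn _ h.2.1, i1, i2]
    apply mul_right_cancel₀ hS.ne'
    linear_combination h1 + h3
  · rw [(hasDerivAt_genCurve a ε e₁ e₃ u).deriv]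
    obtain ⟨i1, i2⟩ := hrel u
    simp only [genCurve, J_add, J_smul, inner_add_left, inner_add_right, real_inner_smul_left,
      real_inner_smul_right, inner_J_J, hn _ h.1, hn _ h.2.1, i1, i2]
    apply mul_right_cancel₀ hS.ne'
    linear_combination -ε * cA a * h1 + ε * cB a * h3
  · obtain ⟨i1, i2⟩ := hrel u
    rw [(hasDerivAt_genCurve a ε e₁ e₃ u).deriv]
    simp only [inner_add_left, inner_add_right, real_inner_smul_left,
      real_inner_smul_right, inner_J_J, hn _ h.1, hn _ h.2.1, i1, i2]
    have hAB' : a * (cA a * cB a) = 1 := by rw [hAB]; field_simp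
    apply mul_right_cancel₀ hS.ne'
    linear_combination a * ε ^ 2 * cA a ^ 2 * h1 + a * ε ^ 2 * cB a ^ 2 * h3 +
      a * cA a * cB a * (cA a + cB a) * hε + (cA a + cB a) * hAB'

/-- With the same weights the curvature is εa(AB³ - A³B)/(A + B) = ε(B - A), by aAB = 1. -/
lemma kap_genCurve {a ε : ℝ} (ha0 : 0 < a) (ha1 : a < 1) (hε : ε ^ 2 = 1) {e₁ e₃ : R4}
    (h : IsAdmissible e₁ e₃) (u : ℝ) : kap a (genCurve a ε e₁ e₃) u = ε * (cB a - cA a) := by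
  have hn : ∀ (s : ℝ) {e : R4}, ‖e‖ = 1 → ⟪rot s e, rot s e⟫_ℝ = 1 := fun s e he => by
    rw [inner_rot_rot, real_inner_self_eq_norm_sq, he]; norm_num
  have hAB' : a * (cA a * cB a) = 1 := by rw [cA_mul_cB ha0 ha1]; field_simp
  have hS := add_pos (cA_pos ha0 ha1) (cB_pos ha0 ha1)
  obtain ⟨i1, -⟩ := h.inner_rot (cA a * (ε * u)) (-(cB a * (ε * u)))
  have i2 : ⟪rot (-(cB a * (ε * u))) e₃, rot (cA a * (ε * u)) e₁⟫_ℝ = 0 := by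
    rw [real_inner_comm]; exact i1
  rw [kap, (hasDerivAt_deriv_genCurve a ε e₁ e₃ u).deriv, (hasDerivAt_genCurve a ε e₁ e₃ u).deriv]
  simp only [J_add, J_smul, J_J, inner_sub_left, inner_add_right, real_inner_smul_left,
    real_inner_smul_right, inner_neg_right, hn _ h.1, hn _ h.2.1, i1, i2]
  apply mul_right_cancel₀ hS.ne'
  linear_combination -(a * ε ^ 3 * cA a ^ 3) * coef₁_sq ha0 ha1 +
    a * ε ^ 3 * cB a ^ 3 * coef₃_sq ha0 ha1 +
    a * cA a * cB a * ε * (cB a ^ 2 - cA a ^ 2) * hε + ε * (cB a ^ 2 - cA a ^ 2) * hAB'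

/-- The explicit curves realize every horizontal initial condition. -/
lemma exists_genCurve {a ε : ℝ} (ha0 : 0 < a) (ha1 : a < 1) (hε : ε ^ 2 = 1) {z T : R4}
    (hz : z ∈ S3) (hT : ⟪T, z⟫_ℝ = 0) (hTJ : ⟪T, J z⟫_ℝ = 0) (hTT : a * ⟪T, T⟫_ℝ = 1) (s : ℝ) :
    ∃ e₁ e₃, IsAdmissible e₁ e₃ ∧ genCurve a ε e₁ e₃ s = z ∧
      deriv (genCurve a ε e₁ e₃) s = T := by
  have hzz := inner_self_of_mem hz
  have hTT' : ⟪T, T⟫_ℝ = cA a * cB a := by rw [cA_mul_cB ha0 ha1]; field_simp; linarith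
  have hzT : ⟪z, T⟫_ℝ = 0 := by rw [real_inner_comm]; exact hT
  have hzJT : ⟪z, J T⟫_ℝ = 0 := by rw [inner_J_comm, hTJ, neg_zero]
  have hA := cA_pos ha0 ha1
  have hB := cB_pos ha0 ha1
  have hS := add_pos hA hB
  have hp := coef₁_pos ha0 ha1
  have hq := coef₃_pos ha0 ha1
  have h1 := coef₁_sq ha0 ha1
  have h3 := coef₃_sq ha0 ha1
  -- f₁ and f₃ solve z = coef₁ f₁ + coef₃ f₃ and JT = ε(A coef₁ f₁ - B coef₃ f₃), the position and
  -- velocity conditions at time s. The witnesses e₁ and e₃ are these vectors turned back to time 0.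
  set f₁ : R4 := (1 / (coef₁ a * (cA a + cB a))) • (cB a • z + ε • J T) with hf₁
  set f₃ : R4 := (1 / (coef₃ a * (cA a + cB a))) • (cA a • z - ε • J T) with hf₃
  have hn1 : ⟪f₁, f₁⟫_ℝ = 1 := by
    simp only [hf₁, inner_add_left, inner_add_right, real_inner_smul_left, real_inner_smul_right,
      inner_J_left, J_J, inner_neg_right, hzz, hTT', hTJ, hzJT]
    field_simp
    linear_combination cB a * cA a * hε - (cA a + cB a) * h1
  have hn3 : ⟪f₃, f₃⟫_ℝ = 1 := by
    simp only [hf₃, inner_sub_left, inner_sub_right, real_inner_smul_left, real_inner_smul_right,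
      inner_J_left, J_J, inner_neg_right, hzz, hTT', hTJ, hzJT]
    field_simp
    linear_combination cB a * cA a * hε - (cA a + cB a) * h3
  have h13 : ⟪f₁, f₃⟫_ℝ = 0 := by
    simp only [hf₁, hf₃, inner_add_left, inner_sub_right, real_inner_smul_left,
      real_inner_smul_right, inner_J_left, J_J, inner_neg_right, hzz, hTT', hTJ, hzJT]
    linear_combination -(1 / (coef₁ a * (cA a + cB a)) * (1 / (coef₃ a * (cA a + cB a))) *
      (cA a * cB a)) * hε
  have h13J : ⟪f₁, J f₃⟫_ℝ = 0 := by
    simp only [hf₁, hf₃, J_sub, J_smul, J_J, inner_neg_right, inner_J_self, inner_add_left,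
      inner_sub_right, real_inner_smul_left,
      real_inner_smul_right, inner_J_left, hzT, hT]
    ring
  have hn : ∀ {x : R4}, ⟪x, x⟫_ℝ = 1 → ‖x‖ = 1 := fun {x} hx => by
    simpa [S3] using mem_of_inner_self hx
  have hd := hasDerivAt_genCurve a ε (rot (-(cA a * (ε * s))) f₁) (rot (cB a * (ε * s)) f₃) s
  rw [rot_rot_neg, rot_neg_rot] at hd
  refine ⟨rot (-(cA a * (ε * s))) f₁, rot (cB a * (ε * s)) f₃,
    ⟨hn (by rw [inner_rot_rot, hn1]), hn (by rw [inner_rot_rot, hn3]), ?_, ?_⟩, ?_, ?_⟩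
  · exact (inner_rot_eq_zero h13 h13J _ _).1
  · rw [inner_J_comm, (inner_rot_eq_zero h13 h13J _ _).2, neg_zero]
  · rw [genCurve, rot_rot_neg, rot_neg_rot, hf₁, hf₃]
    match_scalars <;> field_simp <;> ring
  · rw [hd.deriv, hf₁, hf₃]
    simp only [J_smul, J_add, J_sub, J_J]
    match_scalars
    · field_simp; ring
    · field_simp; linear_combination hε

/-! ### Uniqueness of lifts -/

/-- The energy |x|²/a + |y|² is conserved because J is skew; it vanishes at t₁, hence everywhere on
K. -/
lemma eq_zero_of_ode {a k : ℝ} (ha : 0 < a) {K : Set ℝ} (hK : IsOpen K) (hK' : IsPreconnected K)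
    {x y : ℝ → R4} (hx : ∀ t ∈ K, HasDerivAt x (y t) t)
    (hy : ∀ t ∈ K, HasDerivAt y (-(1 / a) • x t + k • J (y t)) t) {t₁ : ℝ} (ht₁ : t₁ ∈ K)
    (hx₁ : x t₁ = 0) (hy₁ : y t₁ = 0) {t : ℝ} (ht : t ∈ K) : x t = 0 := by
  have hd : ∀ t ∈ K, HasDerivAt (fun t => (1 / a) * ⟪x t, x t⟫_ℝ + ⟪y t, y t⟫_ℝ) 0 t :=
    fun t ht => by
      refine ((((hx t ht).inner ℝ (hx t ht)).const_mul (1 / a)).add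
        ((hy t ht).inner ℝ (hy t ht))).congr_deriv ?_
      simp only [inner_add_left, inner_add_right, real_inner_smul_left, real_inner_smul_right,
        inner_J_left, inner_J_self, real_inner_comm (x t) (y t)]
      ring
  have hconst := hK.is_const_of_deriv_eq_zero hK'
    (fun t ht => (hd t ht).differentiableAt.differentiableWithinAt) (fun t ht => (hd t ht).deriv)
    ht ht₁
  simp only [hx₁, hy₁, inner_zero_left, mul_zero, add_zero] at hconst
  have h1 : 0 ≤ ⟪y t, y t⟫_ℝ := real_inner_self_nonneg
  have h2 : 0 ≤ ⟪x t, x t⟫_ℝ := real_inner_self_nonneg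
  have h3 : ⟪x t, x t⟫_ℝ = 0 := by
    have : 0 ≤ 1 / a * ⟪x t, x t⟫_ℝ := by positivity
    have : 1 / a * ⟪x t, x t⟫_ℝ = 0 := by linarith
    simpa [ha.ne'] using this
  exact inner_self_eq_zero.1 h3

/-- Rotations commute with J, so both curves solve the same linear equation, and their difference
solves it with zero initial data. -/
lemma IsHorLift.eq_rot_of_kap {a k θ : ℝ} (ha : 0 < a) {K : Set ℝ} (hK : IsPreconnected K)
    {γ Γ : ℝ → R4} (H : IsHorLift a K γ) (H' : IsHorLift a K Γ) (hk : ∀ t ∈ K, kap a γ t = k)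
    (hk' : ∀ t ∈ K, kap a Γ t = k) {t₁ : ℝ} (ht₁ : t₁ ∈ K) (h0 : γ t₁ = rot θ (Γ t₁))
    (h1 : deriv γ t₁ = rot θ (deriv Γ t₁)) {t : ℝ} (ht : t ∈ K) : γ t = rot θ (Γ t) := by
  rw [← sub_eq_zero]
  have hr : ∀ {w : ℝ → R4} {w' : R4} {t : ℝ}, HasDerivAt w w' t →
      HasDerivAt (fun t => rot θ (w t)) (rot θ w') t := fun {w w' t} h => by
    simpa using hasDerivAt_rot (hasDerivAt_const t θ) h
  refine eq_zero_of_ode ha H.isOpen hK (x := fun t => γ t - rot θ (Γ t))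
    (y := fun t => deriv γ t - rot θ (deriv Γ t)) (k := k)
    (fun t ht => (H.hasDerivAt ht).sub (hr (H'.hasDerivAt ht))) (fun t ht => ?_) ht₁
    (sub_eq_zero.2 h0) (sub_eq_zero.2 h1) ht
  refine ((H.hasDerivAt_deriv ht).sub (hr (H'.hasDerivAt_deriv ht))).congr_deriv ?_
  rw [H.deriv_deriv ha ht, H'.deriv_deriv ha ht, hk t ht, hk' t ht]
  simp only [rot_vadd, rot_smul, rot_J, J_sub]
  module

/-- Two horizontal lifts of a curve differ by a constant rotation. -/
lemma IsHorLift.exists_rot {a : ℝ} {K : Set ℝ} (hK : IsPreconnected K) {γ Γ : ℝ → R4}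
    (H : IsHorLift a K γ) (H' : IsHorLift a K Γ) (hp : ∀ t ∈ K, proj a (γ t) = proj a (Γ t))
    {t₁ : ℝ} (ht₁ : t₁ ∈ K) : ∃ θ, ∀ t ∈ K, γ t = rot θ (Γ t) := by
  -- The chosen angle need not be continuous. Its cosine and sine are, up to sign, inner products of
  -- the two curves with derivative zero by horizontality.
  choose! θ hθ using fun t ht => exists_rot_of_proj_eq (hp t ht)
  have hc : ∀ t ∈ K, ⟪γ t, Γ t⟫_ℝ = Real.cos (θ t) := fun t ht => by
    rw [hθ t ht, rot, inner_sub_left, real_inner_smul_left, real_inner_smul_left, inner_J_left,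
      inner_J_self, inner_self_of_mem (H'.mem t ht)]
    ring
  have hs : ∀ t ∈ K, ⟪γ t, J (Γ t)⟫_ℝ = -Real.sin (θ t) := fun t ht => by
    rw [hθ t ht, rot, inner_sub_left, real_inner_smul_left, real_inner_smul_left, inner_J_J,
      inner_J_self, inner_self_of_mem (H'.mem t ht)]
    ring
  have key : ∀ t ∈ K, ⟪γ t, deriv Γ t⟫_ℝ = 0 ∧ ⟪deriv γ t, Γ t⟫_ℝ = 0 ∧
      ⟪γ t, J (deriv Γ t)⟫_ℝ = 0 ∧ ⟪deriv γ t, J (Γ t)⟫_ℝ = 0 := fun t ht => by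
    have i1 := H.inner_deriv ht
    have i2 := H.horizontal t ht
    have i3 : ⟪Γ t, deriv Γ t⟫_ℝ = 0 := by rw [real_inner_comm]; exact H'.inner_deriv ht
    have i4 : ⟪Γ t, J (deriv Γ t)⟫_ℝ = 0 := by rw [inner_J_comm, H'.horizontal t ht, neg_zero]
    have hΓ : Γ t = rot (-θ t) (γ t) := by rw [hθ t ht, rot_neg_rot]
    refine ⟨?_, ?_, ?_, ?_⟩
    · rw [hθ t ht, rot, inner_sub_left, real_inner_smul_left, real_inner_smul_left, inner_J_left,
        i3, i4]; simp
    · rw [hΓ, rot, inner_sub_right, real_inner_smul_right, real_inner_smul_right, i1, i2]; simp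
    · rw [hθ t ht, rot, inner_sub_left, real_inner_smul_left, real_inner_smul_left, inner_J_J,
        i3, i4]; simp
    · rw [hΓ, rot, J_sub, J_smul, J_smul, J_J, inner_sub_right, real_inner_smul_right,
        real_inner_smul_right, inner_neg_right, i1, i2]; simp
  have hd1 : ∀ t ∈ K, HasDerivAt (fun t => ⟪γ t, Γ t⟫_ℝ) 0 t := fun t ht =>
    ((H.hasDerivAt ht).inner ℝ (H'.hasDerivAt ht)).congr_deriv (by
      rw [(key t ht).1, (key t ht).2.1, add_zero])
  have hd2 : ∀ t ∈ K, HasDerivAt (fun t => ⟪γ t, J (Γ t)⟫_ℝ) 0 t := fun t ht =>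
    ((H.hasDerivAt ht).inner ℝ (hasDerivAt_J (H'.hasDerivAt ht))).congr_deriv (by
      rw [(key t ht).2.2.1, (key t ht).2.2.2, add_zero])
  refine ⟨θ t₁, fun t ht => ?_⟩
  have c1 := H.isOpen.is_const_of_deriv_eq_zero hK
    (fun t ht => (hd1 t ht).differentiableAt.differentiableWithinAt)
    (fun t ht => (hd1 t ht).deriv) ht ht₁
  have c2 := H.isOpen.is_const_of_deriv_eq_zero hK
    (fun t ht => (hd2 t ht).differentiableAt.differentiableWithinAt)
    (fun t ht => (hd2 t ht).deriv) ht ht₁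
  simp only [hc t ht, hs t ht, hc t₁ ht₁, hs t₁ ht₁, neg_inj] at c1 c2
  rw [hθ t ht, rot, rot, c1, c2]

lemma IsHorLift.kap_rot {a θ : ℝ} {K : Set ℝ} {γ Γ : ℝ → R4} (H' : IsHorLift a K Γ)
    (h : ∀ t ∈ K, γ t = rot θ (Γ t)) {t : ℝ} (ht : t ∈ K) :
    deriv γ t = rot θ (deriv Γ t) ∧ kap a γ t = kap a Γ t := by
  have hr : ∀ {w : ℝ → R4} {w' : R4} {t : ℝ}, HasDerivAt w w' t →
      HasDerivAt (fun t => rot θ (w t)) (rot θ w') t := fun {w w' t} h => by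
    simpa using hasDerivAt_rot (hasDerivAt_const t θ) h
  have h1 : ∀ t ∈ K, deriv γ t = rot θ (deriv Γ t) := fun t ht => by
    have e : γ =ᶠ[𝓝 t] fun t => rot θ (Γ t) := by
      filter_upwards [H'.isOpen.mem_nhds ht] with s hs using h s hs
    rw [e.deriv_eq, (hr (H'.hasDerivAt ht)).deriv]
  refine ⟨h1 t ht, ?_⟩
  have e : deriv γ =ᶠ[𝓝 t] fun t => rot θ (deriv Γ t) := by
    filter_upwards [H'.isOpen.mem_nhds ht] with s hs using h1 s hs
  rw [kap, e.deriv_eq, (hr (H'.hasDerivAt_deriv ht)).deriv, h1 t ht, inner_rot_J_rot, kap]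

/-! ### Classification -/

lemma IsHorLift.kap_eq {a : ℝ} (ha : 0 < a) {I K : Set ℝ} {c : ℝ → Set R4} {γ : ℝ → R4}
    (hb : IsBiharmonic a I c) (hK : IsPreconnected K) (H : IsHorLift a K γ) (hKI : K ⊆ I)
    (hc : ∀ t ∈ K, proj a (γ t) = c t) {s t : ℝ} (hs : s ∈ K) (ht : t ∈ K) :
    kap a γ t = kap a γ s :=
  H.isOpen.is_const_of_deriv_eq_zero hK
    (H.contDiffOn_kap.differentiableOn (by simp)) (kap_of_isBiharmonic ha hb H hKI hc).1 ht hs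

/-- A point of non-zero tension has κ ≠ 0, hence κ = ε(B - A) on a ball. The explicit curve with the
same position and velocity there coincides with the lift by uniqueness, and the equality of
projections then spreads over I. -/
lemma exists_genCurve_of_isProperBiharmonic {a : ℝ} (ha0 : 0 < a) (ha1 : a < 1) {I : Set ℝ}
    {c : ℝ → Set R4} (hI : IsOpen I) (hI' : I.OrdConnected) (hc : IsUnitSpeedCurve a I c)
    (hb : IsProperBiharmonic a I c) :
    ∃ ε : ℝ, (ε = 1 ∨ ε = -1) ∧ ∃ e₁ e₃, IsAdmissible e₁ e₃ ∧
      ∀ t ∈ I, proj a (genCurve a ε e₁ e₃ t) = c t := by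
  obtain ⟨hb, hnh⟩ := hb
  simp only [IsHarmonic, not_forall] at hnh
  obtain ⟨U, F, ⟨hU, hF, hi, σ, hσ, hm⟩, p, hp, hne⟩ := hnh
  have hs₀ := (hm p hp).1
  obtain ⟨δ, hδ, γ, hδI, H, hγc⟩ := exists_horLift ha0 hI hc hs₀
  have hs₀' : σ p ∈ Metric.ball (σ p) δ := Metric.mem_ball_self hδ
  obtain ⟨U', φ, hp', hφ, hflat⟩ :=
    IsLocalParam.exists_flatFactor ha0 H hγc hU hF hi hσ hm hp hs₀'
  have hk0 : kap a γ (σ p) ≠ 0 := fun h0 => hne (by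
    rw [H.tension_tube ha0 hflat hp', hφ, h0, zero_smul, rot_vzero])
  have hk2 := ((kap_of_isBiharmonic ha0 hb H hδI hγc).2 _ hs₀').resolve_left hk0
  rw [← cB_sub_cA_sq ha0 ha1, sq_eq_sq_iff_eq_or_eq_neg] at hk2
  obtain ⟨ε, hε, hkε⟩ : ∃ ε : ℝ, (ε = 1 ∨ ε = -1) ∧ kap a γ (σ p) = ε * (cB a - cA a) := by
    rcases hk2 with h | h
    · exact ⟨1, Or.inl rfl, by rw [h, one_mul]⟩
    · exact ⟨-1, Or.inr rfl, by rw [h, neg_one_mul]⟩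
  have hε2 : ε ^ 2 = 1 := by rcases hε with rfl | rfl <;> norm_num
  obtain ⟨e₁, e₃, hadm, hg0, hg1⟩ := exists_genCurve ha0 ha1 hε2 (H.mem _ hs₀')
    (H.inner_deriv hs₀') (H.horizontal _ hs₀') (H.unit _ hs₀') (σ p)
  refine ⟨ε, hε, e₁, e₃, hadm, ?_⟩
  have hΓ := isHorLift_genCurve ha0 ha1 hε2 hadm
  have hΓk := kap_genCurve ha0 ha1 hε2 hadm
  have hball : ∀ s r : ℝ, IsPreconnected (Metric.ball s r) := fun s r =>
    (convex_ball s r).isPreconnected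
  set Γ := genCurve a ε e₁ e₃
  -- S is open by construction, so it remains to see that it meets I and contains its limit points
  -- in I.
  let S : Set ℝ := {s | ∀ᶠ t in 𝓝 s, proj a (Γ t) = c t}
  suffices hIS : I ⊆ S from fun t ht => (hIS ht).self_of_nhds
  refine IsPreconnected.subset_of_closure_inter_subset hI'.isPreconnected
    isOpen_setOfPred_eventually_nhds ⟨σ p, hs₀, ?_⟩ ?_
  · filter_upwards [Metric.ball_mem_nhds (σ p) hδ] with t ht
    have h := H.eq_rot_of_kap ha0 (hball _ _) (θ := 0) (k := ε * (cB a - cA a))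
      (hΓ.mono Metric.isOpen_ball (Set.subset_univ _))
      (fun t ht => by rw [← hkε]; exact H.kap_eq ha0 hb (hball _ _) hδI hγc hs₀' ht)
      (fun t _ => hΓk t) hs₀' (by rw [rot_zero, hg0]) (by rw [rot_zero, hg1]) ht
    rw [← hγc t ht, h, rot_zero]
  -- Some t₁ in S lies in a ball about s that carries a lift β. Near t₁ the lift is a constant
  -- rotation of Γ, so it has the curvature of Γ at t₁. Biharmonicity keeps that curvature constant
  -- on the whole ball, and uniqueness carries the agreement to a neighbourhood of s.
  · rintro s ⟨hs, hsI⟩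
    obtain ⟨δ', hδ', β, hδI', H', hβc⟩ := exists_horLift ha0 hI hc hsI
    obtain ⟨t₁, ht₁, ht₁S⟩ := mem_closure_iff.1 hs _ Metric.isOpen_ball (Metric.mem_ball_self hδ')
    obtain ⟨r, hr, hrS⟩ := Metric.mem_nhds_iff.1
      (Filter.inter_mem ht₁S (Metric.isOpen_ball.mem_nhds ht₁))
    have hrb : Metric.ball t₁ r ⊆ Metric.ball s δ' := fun t ht => (hrS ht).2
    have hΓr := hΓ.mono (Metric.isOpen_ball (x := t₁) (ε := r)) (Set.subset_univ _)
    obtain ⟨θ, hθ⟩ := (H'.mono Metric.isOpen_ball hrb).exists_rot (hball _ _) hΓr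
      (fun t ht => (hβc t (hrb ht)).trans (hrS ht).1.symm) (Metric.mem_ball_self hr)
    obtain ⟨hd, hk⟩ := hΓr.kap_rot hθ (Metric.mem_ball_self hr)
    filter_upwards [Metric.ball_mem_nhds s hδ'] with t ht
    have h := H'.eq_rot_of_kap ha0 (hball _ _) (θ := θ) (k := ε * (cB a - cA a))
      (hΓ.mono Metric.isOpen_ball (Set.subset_univ _))
      (fun t ht => by rw [← hΓk t₁, ← hk]; exact H'.kap_eq ha0 hb (hball _ _) hδI' hβc ht₁ ht)
      (fun t _ => hΓk t) ht₁ (hθ _ (Metric.mem_ball_self hr)) hd ht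
    rw [← hβc t ht, h, proj_rot ha0]

lemma isUnitSpeedCurve_of_horLift {a : ℝ} {γ : ℝ → R4} (H : IsHorLift a Set.univ γ) :
    IsUnitSpeedCurve a Set.univ fun u => proj a (γ u) := by
  refine fun s _ => ⟨γ, Set.univ, isOpen_univ, trivial, H.smooth, fun t ht => ⟨H.mem t ht, rfl, ?_⟩⟩
  have h0 : eta0 (γ t) (deriv γ t) = 0 := by rw [eta0_eq, H.horizontal t ht, neg_zero]
  have h1 : hor a (γ t) (deriv γ t) = deriv γ t := by simp [hor, eta, h0]
  rw [h1, g, h0, H.unit t ht]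
  ring

end TannoSphere

end

open TannoSphere in
theorem theorem4p1 (a : ℝ) (ha0 : 0 < a) (ha1 : a < 1) :
    (∀ (I : Set ℝ) (c : ℝ → Set R4), IsOpen I → I.OrdConnected → I.Nonempty →
      IsUnitSpeedCurve a I c →
        (IsProperBiharmonic a I c ↔
          ∃ ε : ℝ, (ε = 1 ∨ ε = -1) ∧ ∃ e₁ e₃ : R4, IsAdmissible e₁ e₃ ∧
            IsParametrization a I c (fun u v => surf a e₁ e₃ (ε * u) v))) ∧
    (∀ e₁ e₃ : R4, IsAdmissible e₁ e₃ →
      ∃ c : ℝ → Set R4, IsUnitSpeedCurve a Set.univ c ∧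
        IsParametrization a Set.univ c (surf a e₁ e₃) ∧
        IsProperBiharmonic a Set.univ c) := by
  have hsurf : ∀ (ε : ℝ) (e₁ e₃ : R4), (fun u v => surf a e₁ e₃ (ε * u) v) =
      fun u v => rot (v / a) (genCurve a ε e₁ e₃ u) := fun ε e₁ e₃ => by
    funext u v; exact surf_eq a ε e₁ e₃ u v
  have hk2 : ∀ {ε : ℝ}, ε ^ 2 = 1 → (ε * (cB a - cA a)) ^ 2 = 4 * (1 - a) / a := fun hε => by
    rw [mul_pow, hε, one_mul, cB_sub_cA_sq ha0 ha1]
  refine ⟨fun I c hI hI' hne hc => ⟨fun hb => ?_, ?_⟩, fun e₁ e₃ hadm => ?_⟩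
  · obtain ⟨ε, hε, e₁, e₃, hadm, h⟩ := exists_genCurve_of_isProperBiharmonic ha0 ha1 hI hI' hc hb
    refine ⟨ε, hε, e₁, e₃, hadm, ?_⟩
    rw [hsurf]
    have hε2 : ε ^ 2 = 1 := by rcases hε with rfl | rfl <;> norm_num
    exact isParametrization_of_horLift ha0
      ((isHorLift_genCurve ha0 ha1 hε2 hadm).mono hI (Set.subset_univ _)) h
  · rintro ⟨ε, hε, e₁, e₃, hadm, hX⟩
    rw [hsurf] at hX
    have hε2 : ε ^ 2 = 1 := by rcases hε with rfl | rfl <;> norm_num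
    exact isProperBiharmonic_of_horLift ha0 ha1 hne
      ((isHorLift_genCurve ha0 ha1 hε2 hadm).mono hI (Set.subset_univ _))
      -- Only the fibre clause of the parametrization is used: the orbit of the generating curve at
      -- t is the range of the line over t, which is c t.
      (fun t ht => by rw [proj_eq]; exact (hX.2.2 t ht).1)
      (fun t _ => kap_genCurve ha0 ha1 hε2 hadm t) (hk2 hε2)
  · have H := isHorLift_genCurve ha0 ha1 (one_pow 2) hadm
    have hX := isParametrization_of_horLift ha0 H (c := fun u => proj a (genCurve a 1 e₁ e₃ u))
      fun _ _ => rfl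
    rw [← hsurf] at hX
    simp only [one_mul] at hX
    exact ⟨_, isUnitSpeedCurve_of_horLift H, hX,
      isProperBiharmonic_of_horLift ha0 ha1 Set.univ_nonempty H (fun _ _ => rfl)
        (fun t _ => kap_genCurve ha0 ha1 (one_pow 2) hadm t) (hk2 (one_pow 2))⟩
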